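/- Let $n\ge 3$ and $c>0$. On $\mathbb{R}^n$ with coordinates $(x_0,\dots,x_{n-1})$ consider the frame $e_0=\frac1c\partial_0$, $e_1=\partial_1-x_2\partial_0$, $e_i=\partial_i$ for $2\le i\le n-1$, and let $g^c_n$ be the Lorentzian metric for which this frame is orthonormal with $e_0$ timelike, i.e. $g^c_n=-c^2(dx_0+x_2\,dx_1)^2+dx_1^2+\dots+dx_{n-1}^2$. A vector $v$ is timelike if $g(v,v)<0$, lightlike if $v\ne0$ and $g(v,v)=0$, causal if it is timelike or lightlike, and spacelike if $g(v,v)>0$. A closed geodesic is a nonconstant periodic geodesic $\mathbb{R}\to\mathbb{R}^n$; a closed $C^r$ path is a periodic $C^r$ map $\mathbb{R}\to\mathbb{R}^n$ (its restriction to one period). The following statements hold. 1. The map $\varphi_c(x_0,x_1,\dots,x_{n-1})=(c^2x_0,cx_1,\dots,cx_{n-1})$ is a diffeomorphism of $\mathbb{R}^n$ with $g^c_n=\frac1{c^2}\varphi_c^*(g^1_n)$; thus $c^2g^c_n$ is isometric to $g^1_n$. 2. $g^c_n$ is geodesically complete. 3. $g^c_n$ has no closed causal geodesic. But for every $p\in\mathbb{R}^n$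 there is a $1$-parameter family of closed spacelike geodesics through $p$: there is a smooth map $\Gamma:\mathbb{R}\times\mathbb{R}\to\mathbb{R}^n$ such that each $\Gamma(s,\cdot)$ is a closed spacelike geodesic with $\Gamma(s,0)=p$, and the images of $\Gamma(s,\cdot)$ for distinct $s$ are distinct. 4. Let $r\in\{1,2,\dots\}\cup\{\infty\}$ and let $a<b$ be real numbers. Every $g^c_3$-timelike $C^r$ path $w:[a,b]\to\mathbb{R}^3$ (i.e. $w'(t)$ is timelike for all $t$) extends to a closed $g^c_3$-timelike $C^r$ path, i.e. there are $\alpha\le a$, $\beta\ge b$ and a $(\beta-\alpha)$-periodic $g^c_3$-timelike $C^r$ map $\gamma:\mathbb{R}\to\mathbb{R}^3$ with $\gamma=w$ on $[a,b]$. Moreover, for every $p\in\mathbb{R}^n$ there is a closed $g^c_n$-timelike $C^r$ path through $p$. 5. $g^c_n$ satisfies the timelike convergence condition: $\mathrm{Ric}(v,v)\ge0$ for every timelike $v$. For every real $\Lambda\le\frac{c^2}{4}$ it satisfies the dominant energy condition with respect to the cosmological constant $\Lambda$: with $T=\mathrm{Ric}-\frac12\mathrm{scal}\,g+\Lambda g$,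 for every timelike vector $v$ one has $T(v,v)\ge0$ and the vector $-\sharp(T(v,\cdot))$ is not spacelike, where $\sharp:T^*\mathbb{R}^n\to T\mathbb{R}^n$ is the isomorphism induced by $g=g^c_n$. -/

import Mathlib

open scoped Matrix ContDiff

noncomputable section

/-! Tensor calculus on `ℝ^N` in the standard coordinates. -/

/-- A field of `N × N` matrices on `ℝ^N`: the components `g_{ij}` of a (semi-Riemannian) metric with
respect to the standard coordinates. -/
abbrev MetricField (N : ℕ) : Type := (Fin N → ℝ) → Matrix (Fin N) (Fin N) ℝ

/-- The value `g_x(v, w)`. -/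
def metricForm {N : ℕ} (g : MetricField N) (x v w : Fin N → ℝ) : ℝ := v ⬝ᵥ (g x *ᵥ w)

/-- `g` is a smooth Lorentzian metric: smooth, symmetric, and at every point there is a vector `u` with
`g(u, u) < 0` on whose orthogonal complement `g` is positive definite. -/
structure IsLorentzMetric {N : ℕ} (g : MetricField N) : Prop where
  smooth : ∀ i j, ContDiff ℝ ∞ fun x => g x i j
  symm : ∀ x, (g x).IsSymm
  index_one : ∀ x, ∃ u, metricForm g x u u < 0 ∧
    ∀ v, v ≠ 0 → metricForm g x u v = 0 → 0 < metricForm g x v v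

/-- `∂f / ∂x_k` at `x`. -/
def partialDeriv {N : ℕ} (k : Fin N) (f : (Fin N → ℝ) → ℝ) (x : Fin N → ℝ) : ℝ :=
  fderiv ℝ f x (Pi.single k 1)

/-- The Christoffel symbol `Γ_{ij}^k` of the Levi-Civita connection of `g`. -/
def christoffel {N : ℕ} (g : MetricField N) (k i j : Fin N) (x : Fin N → ℝ) : ℝ :=
  (1 / 2) * ∑ l, (g x)⁻¹ k l *
    (partialDeriv i (fun y => g y j l) x + partialDeriv j (fun y => g y i l) x
      - partialDeriv l (fun y => g y i j) x)

/-- The component `R^l_{kij}` of the curvature tensor, i.e.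
`(∇_i ∇_j - ∇_j ∇_i) ∂_k = ∑ l, R^l_{kij} ∂_l`. -/
def riemannCurv {N : ℕ} (g : MetricField N) (l k i j : Fin N) (x : Fin N → ℝ) : ℝ :=
  partialDeriv i (christoffel g l j k) x - partialDeriv j (christoffel g l i k) x
    + ∑ p, (christoffel g l i p x * christoffel g p j k x
      - christoffel g l j p x * christoffel g p i k x)

/-- The Ricci tensor `Ric(Y, Z) = trace (X ↦ R(X, Y) Z)`. -/
def ricci {N : ℕ} (g : MetricField N) : MetricField N :=
  fun x => Matrix.of fun j k => ∑ i, riemannCurv g i k i j x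

/-- The scalar curvature: the `g`-trace of the Ricci tensor. -/
def scalarCurv {N : ℕ} (g : MetricField N) (x : Fin N → ℝ) : ℝ :=
  ∑ i, ∑ j, (g x)⁻¹ i j * ricci g x i j

/-- The energy-momentum tensor `T = Ric - (1/2) scal g + Λ g`. -/
def energyMomentum {N : ℕ} (g : MetricField N) (Λ : ℝ) : MetricField N :=
  fun x => ricci g x - ((1 / 2) * scalarCurv g x) • g x + Λ • g x

/-! Causal character of vectors and curvature conditions. -/

def IsTimelike {N : ℕ} (g : MetricField N) (x v : Fin N → ℝ) : Prop := metricForm g x v v < 0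

def IsLightlike {N : ℕ} (g : MetricField N) (x v : Fin N → ℝ) : Prop :=
  v ≠ 0 ∧ metricForm g x v v = 0

def IsCausal {N : ℕ} (g : MetricField N) (x v : Fin N → ℝ) : Prop :=
  IsTimelike g x v ∨ IsLightlike g x v

/-- Spacelike vectors are nonzero by convention. -/
def IsSpacelike {N : ℕ} (g : MetricField N) (x v : Fin N → ℝ) : Prop := 0 < metricForm g x v v

/-- The vector `♯(T(v, ·))` for a bilinear form field `T`, i.e. the vector `w` with
`g(w, ·) = T(v, ·)`. -/
def sharpOf {N : ℕ} (g T : MetricField N) (x v : Fin N → ℝ) : Fin N → ℝ :=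
  (g x)⁻¹ *ᵥ (v ᵥ* T x)

def TimelikeConvergence {N : ℕ} (g : MetricField N) : Prop :=
  ∀ x v, IsTimelike g x v → 0 ≤ metricForm (ricci g) x v v

def WeakEnergyCondition {N : ℕ} (g : MetricField N) (Λ : ℝ) : Prop :=
  ∀ x v, IsTimelike g x v → 0 ≤ metricForm (energyMomentum g Λ) x v v

def SemiDominantEnergyCondition {N : ℕ} (g : MetricField N) (Λ : ℝ) : Prop :=
  ∀ x v, IsTimelike g x v → ¬ IsSpacelike g x (-sharpOf g (energyMomentum g Λ) x v)

def DominantEnergyCondition {N : ℕ} (g : MetricField N) (Λ : ℝ) : Prop :=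
  WeakEnergyCondition g Λ ∧ SemiDominantEnergyCondition g Λ

/-! Isometries. -/

/-- `f` is a smooth diffeomorphism of `ℝ^N`. -/
def IsDiffeo {N : ℕ} (f : (Fin N → ℝ) → (Fin N → ℝ)) : Prop :=
  ContDiff ℝ ∞ f ∧ ∃ f' : (Fin N → ℝ) → (Fin N → ℝ), ContDiff ℝ ∞ f' ∧
    Function.LeftInverse f' f ∧ Function.RightInverse f' f

/-- The pullback `f^* g`, given by `(f^* g)_x(v, w) = g_{f(x)}(Df_x v, Df_x w)`. -/
def pullbackMetric {N : ℕ} (f : (Fin N → ℝ) → (Fin N → ℝ)) (g : MetricField N) : MetricField N :=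
  fun x => Matrix.of fun i j =>
    metricForm g (f x) (fderiv ℝ f x (Pi.single i 1)) (fderiv ℝ f x (Pi.single j 1))

/-- `(ℝ^N, g)` and `(ℝ^N, h)` are isometric. -/
def AreIsometric {N : ℕ} (g h : MetricField N) : Prop :=
  ∃ f, IsDiffeo f ∧ pullbackMetric f h = g

/-! Geodesics and paths. -/

/-- `γ : ℝ → ℝ^N` is a geodesic defined on the whole real line. -/
def IsGeodesic {N : ℕ} (g : MetricField N) (γ : ℝ → Fin N → ℝ) : Prop :=
  ContDiff ℝ ∞ γ ∧ ∀ t k, deriv (deriv γ) t k =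
    -∑ i, ∑ j, christoffel g k i j (γ t) * deriv γ t i * deriv γ t j

/-- For each tangent vector `v` at each point `p`, the geodesic with initial velocity `v` exists for
all times. -/
def GeodesicallyComplete {N : ℕ} (g : MetricField N) : Prop :=
  ∀ p v : Fin N → ℝ, ∃ γ, IsGeodesic g γ ∧ γ 0 = p ∧ deriv γ 0 = v

/-- A closed geodesic: a periodic geodesic which is not constant. -/
def IsClosedGeodesic {N : ℕ} (g : MetricField N) (γ : ℝ → Fin N → ℝ) : Prop :=
  IsGeodesic g γ ∧ (∃ T > 0, Function.Periodic γ T) ∧ ∃ t, deriv γ t ≠ 0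

def IsClosedCausalGeodesic {N : ℕ} (g : MetricField N) (γ : ℝ → Fin N → ℝ) : Prop :=
  IsClosedGeodesic g γ ∧ ∀ t, IsCausal g (γ t) (deriv γ t)

def IsClosedSpacelikeGeodesic {N : ℕ} (g : MetricField N) (γ : ℝ → Fin N → ℝ) : Prop :=
  IsClosedGeodesic g γ ∧ ∀ t, IsSpacelike g (γ t) (deriv γ t)

/-- A timelike path of class `C^r` on `[a, b]` (one-sided derivatives at the end points). -/
def IsTimelikePathOn {N : ℕ} (g : MetricField N) (r : ℕ∞) (a b : ℝ) (w : ℝ → Fin N → ℝ) : Prop :=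
  ContDiffOn ℝ r w (Set.Icc a b) ∧
    ∀ t ∈ Set.Icc a b, IsTimelike g (w t) (derivWithin w (Set.Icc a b) t)

/-- A closed timelike path of class `C^r` (so that it closes up with all its derivatives of order at
most `r`), given as a periodic map with period `T`. -/
def IsClosedTimelikePath {N : ℕ} (g : MetricField N) (r : ℕ∞) (T : ℝ) (γ : ℝ → Fin N → ℝ) : Prop :=
  0 < T ∧ ContDiff ℝ r γ ∧ Function.Periodic γ T ∧ ∀ t, IsTimelike g (γ t) (deriv γ t)

/-! The explicit metrics. The dimension is `n = m + 3`, with `m : ℕ` arbitrary. -/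

/-- The components of the `1`-form `dx_0 + x_2 dx_1`. -/
def twistForm {m : ℕ} (x : Fin (m + 3) → ℝ) (i : Fin (m + 3)) : ℝ :=
  if i = 0 then 1 else if i = 1 then x 2 else 0

/-- The metric `g^c_n = -c^2 (dx_0 + x_2 dx_1)^2 + dx_1^2 + ⋯ + dx_{n-1}^2` on `ℝ^n`, `n = m + 3`.
By `explicitMetric_frame` and `explicitFrame_span` it is the one for which the frame `explicitFrame`
is orthonormal with `e_0` timelike. -/
def explicitMetric (m : ℕ) (c : ℝ) : MetricField (m + 3) :=
  fun x => Matrix.of fun i j =>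
    (if i = j ∧ i ≠ 0 then 1 else 0) - c ^ 2 * twistForm x i * twistForm x j

/-- The frame `e_0 = (1/c) ∂_0`, `e_1 = ∂_1 - x_2 ∂_0`, and `e_i = ∂_i` for `i ≥ 2`. -/
def explicitFrame {m : ℕ} (c : ℝ) (x : Fin (m + 3) → ℝ) (i : Fin (m + 3)) : Fin (m + 3) → ℝ :=
  if i = 0 then (1 / c) • Pi.single 0 1
  else if i = 1 then Pi.single 1 1 - x 2 • Pi.single 0 1
  else Pi.single i 1

/-- The map `(x_0, x_1, …, x_{n-1}) ↦ (c^2 x_0, c x_1, …, c x_{n-1})`. -/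
def scalingMap (m : ℕ) (c : ℝ) : (Fin (m + 3) → ℝ) → (Fin (m + 3) → ℝ) :=
  fun x i => if i = 0 then c ^ 2 * x i else c * x i

theorem metricForm_explicitMetric {m : ℕ} (c : ℝ) (x v w : Fin (m + 3) → ℝ) :
    metricForm (explicitMetric m c) x v w =
      -c ^ 2 * (v 0 + x 2 * v 1) * (w 0 + x 2 * w 1) + ∑ i : Fin (m + 2), v i.succ * w i.succ := by
  have hT : ∀ u : Fin (m + 3) → ℝ, ∑ i, twistForm x i * u i = u 0 + x 2 * u 1 := by
    intro u
    have h10 : (1 : Fin (m + 3)) ≠ 0 := by simp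
    have h : ∀ i, twistForm x i * u i =
        (if i = 0 then u 0 else 0) + (if i = 1 then x 2 * u 1 else 0) := by
      intro i
      unfold twistForm
      by_cases h0 : i = 0
      · subst h0; simp [h10.symm]
      · by_cases h1 : i = 1
        · subst h1; simp [h10]
        · simp [h0, h1]
    simp_rw [h, Finset.sum_add_distrib]
    simp
  have hD : ∑ i, ∑ j, v i * ((if i = j ∧ i ≠ 0 then (1 : ℝ) else 0) * w j) =
      ∑ i : Fin (m + 2), v i.succ * w i.succ := by
    rw [Fin.sum_univ_succ]
    simp [Fin.succ_ne_zero]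
  calc metricForm (explicitMetric m c) x v w
      = ∑ i, ∑ j, v i * ((if i = j ∧ i ≠ 0 then (1 : ℝ) else 0) * w j)
          - c ^ 2 * (∑ i, twistForm x i * v i) * (∑ j, twistForm x j * w j) := by
        simp only [metricForm, dotProduct, Matrix.mulVec, explicitMetric, Matrix.of_apply]
        rw [mul_assoc, Finset.sum_mul_sum, Finset.mul_sum, ← Finset.sum_sub_distrib]
        refine Finset.sum_congr rfl fun i _ => ?_
        rw [Finset.mul_sum, Finset.mul_sum, ← Finset.sum_sub_distrib]
        refine Finset.sum_congr rfl fun j _ => ?_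
        ring
    _ = _ := by rw [hD, hT, hT]; ring

theorem explicitMetric_frame {m : ℕ} {c : ℝ} (hc : 0 < c) (x : Fin (m + 3) → ℝ)
    (i j : Fin (m + 3)) :
    metricForm (explicitMetric m c) x (explicitFrame c x i) (explicitFrame c x j) =
      if i = j then (if i = 0 then -1 else 1) else 0 := by
  have h10 : (1 : Fin (m + 3)) ≠ 0 := by simp
  have hθ : ∀ k : Fin (m + 3), explicitFrame c x k 0 + x 2 * explicitFrame c x k 1 =
      if k = 0 then 1 / c else 0 := by
    intro k
    unfold explicitFrame
    by_cases h0 : k = 0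
    · subst h0; simp [h10]
    · by_cases h1 : k = 1
      · subst h1; simp [h10]
      · simp [h0, h1, Ne.symm h0, Ne.symm h1]
  have hs : ∀ (k : Fin (m + 3)) (l : Fin (m + 2)), explicitFrame c x k l.succ =
      if k = l.succ then 1 else 0 := by
    intro k l
    have hl := Fin.succ_ne_zero l
    unfold explicitFrame
    by_cases h0 : k = 0
    · subst h0; simp [hl, Ne.symm hl]
    · by_cases h1 : k = 1
      · subst h1; simp [h10, hl, Pi.single_apply, eq_comm]
      · simp [h0, h1, Pi.single_apply, eq_comm]
  rw [metricForm_explicitMetric, hθ, hθ]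
  simp_rw [hs]
  have hc' := hc.ne'
  refine Fin.cases ?_ (fun k => ?_) i
  · refine Fin.cases ?_ (fun l => ?_) j
    · simp [Ne.symm (Fin.succ_ne_zero _)]
      field_simp
    · simp [Ne.symm (Fin.succ_ne_zero _)]
  · rw [Finset.sum_eq_single k]
    · by_cases h : j = k.succ
      · simp [h]
      · simp [h, Ne.symm h]
    · intro l _ hl
      simp [Ne.symm hl]
    · simp

theorem explicitFrame_span {m : ℕ} {c : ℝ} (hc : 0 < c) (x : Fin (m + 3) → ℝ) :
    Submodule.span ℝ (Set.range (explicitFrame c x)) = ⊤ := by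
  have h10 : (1 : Fin (m + 3)) ≠ 0 := by simp
  set S := Submodule.span ℝ (Set.range (explicitFrame c x)) with hS
  have hm : ∀ i, explicitFrame c x i ∈ S := fun i => Submodule.subset_span ⟨i, rfl⟩
  have e0 : (Pi.single 0 1 : Fin (m + 3) → ℝ) ∈ S := by
    have h := S.smul_mem c (hm 0)
    rwa [explicitFrame, if_pos rfl, smul_smul, mul_one_div_cancel hc.ne', one_smul] at h
  have hb : ∀ i, (Pi.single i 1 : Fin (m + 3) → ℝ) ∈ S := by
    intro i
    by_cases h0 : i = 0
    · subst h0; exact e0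
    · by_cases h1 : i = 1
      · subst h1
        have h := S.add_mem (hm 1) (S.smul_mem (x 2) e0)
        rwa [explicitFrame, if_neg h10, if_pos rfl, sub_add_cancel] at h
      · have h := hm i
        rwa [explicitFrame, if_neg h0, if_neg h1] at h
  rw [eq_top_iff]
  intro v _
  rw [pi_eq_sum_univ' v]
  exact S.sum_mem fun i _ => S.smul_mem _ (hb i)

theorem isLorentzMetric_explicitMetric (m : ℕ) {c : ℝ} (hc : 0 < c) :
    IsLorentzMetric (explicitMetric m c) where
  smooth i j := by
    have h : ∀ k, ContDiff ℝ ∞ fun x : Fin (m + 3) → ℝ => twistForm x k := by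
      intro k
      unfold twistForm
      split_ifs <;> fun_prop
    simp only [explicitMetric, Matrix.of_apply]
    exact contDiff_const.sub ((contDiff_const.mul (h i)).mul (h j))
  symm x := by
    ext i j
    simp only [explicitMetric, Matrix.transpose_apply, Matrix.of_apply]
    by_cases h : i = j
    · subst h; ring
    · simp [h, Ne.symm h]; ring
  index_one x := by
    have h10 : (1 : Fin (m + 3)) ≠ 0 := by simp
    have hc2 : 0 < c ^ 2 := by positivity
    refine ⟨Pi.single 0 1, ?_, fun v hv h => ?_⟩
    · rw [metricForm_explicitMetric]
      simpa [h10] using hc2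
    · rw [metricForm_explicitMetric] at h ⊢
      have hv0 : v 0 + x 2 * v 1 = 0 := by simpa [h10, hc.ne'] using h
      rw [hv0, mul_zero, zero_add]
      refine lt_of_le_of_ne (Finset.sum_nonneg fun i _ => mul_self_nonneg _) fun h0 => hv ?_
      have hz := (Finset.sum_eq_zero_iff_of_nonneg
        (fun (i : Fin (m + 2)) _ => mul_self_nonneg (v i.succ))).1 h0.symm
      have hz' : ∀ i : Fin (m + 2), v i.succ = 0 := fun i =>
        mul_self_eq_zero.1 (hz i (Finset.mem_univ i))
      have h1 : v 1 = 0 := hz' 0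
      funext i
      refine Fin.cases ?_ (fun k => ?_) i
      · simpa [h1] using hv0
      · exact hz' k

end

open scoped Matrix ContDiff

noncomputable section

/-! Borel's lemma and extension of `C^r` maps from a compact interval. -/

/-! Write θ = dx_0 + x_2 dx_1, so that g = -c²θ² + dx_1² + ⋯. Every component of g, g⁻¹ and the
Christoffel symbols is a polynomial of degree at most 2 in x_2 alone, and the directions of index ≥
3 are flat, so the curvature claims are finite computations. They give Ric = (c²/2)(dx_1² + dx_2²) +
(c⁴/2)θ², a sum of squares, and scal = c²/2. Hence T = Ric + (Λ - c²/4) g, which the frame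
diagonalizes (`ricci_explicitMetric`, `dominantEnergyCondition_explicitMetric`).

Geodesics: ∂_0 is a Killing field, so E = c² θ(γ') is constant, and the pair (x_1', x_2') rotates
with angular speed E. The equations integrate explicitly, to a `helix` if E ≠ 0 and to a polynomial
if E = 0, which gives completeness. With ρ = x_1'² + x_2'², a corrected version of x_0 drifts at the
constant rate 2E³/c² - Eρ. A periodic geodesic with E ≠ 0 thus has ρ = 2E²/c², which forces g(γ',
γ') ≥ E²/c² > 0. If E = 0, then g(γ', γ') is a sum of squares, and a causal γ' would vanish.
Conversely E = c, ρ = 2 gives closed spacelike geodesics over circles through p, one for each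
initial direction.

Timelike extension in dimension 3: with y = x_0 + x_1 x_2 / 2 one has θ = dy + (x_2 dx_1 - x_1
dx_2)/2, so θ is the increment of y plus a signed area element. A circular loop of size L in the
(x_1, x_2)-plane has length of order L but area of order L². A large loop therefore pays for any
required decrease of y while the curve stays timelike (`exists_closing_of_compact`). The given path
is first extended to a C^r map on the line by Borel's lemma, and at the end a curve that agrees with
its own translate on an open window is made periodic. -/

theorem exists_iteratedDeriv_bound {f : ℝ → ℝ} (hf : ContDiff ℝ ∞ f) (hs : HasCompactSupport f)
    (k : ℕ) : ∃ C, ∀ x, ‖iteratedDeriv k f x‖ ≤ C := by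
  obtain ⟨C, hC⟩ := Continuous.bounded_above_of_compact_support
    (hf.continuous_iteratedFDeriv (m := k) (by exact_mod_cast le_top)) (hs.iteratedFDeriv k)
  exact ⟨C, fun x => by rw [← norm_iteratedFDeriv_eq_norm_iteratedDeriv]; exact hC x⟩

theorem iteratedDeriv_smul_comp_mul {E : Type*} [NormedAddCommGroup E] [NormedSpace ℝ E]
    {f : ℝ → ℝ} (hf : ContDiff ℝ ∞ f) (u l : ℝ) (d : E) (k : ℕ) (x : ℝ) :
    iteratedDeriv k (fun t => (u * f (l * t)) • d) x =
      (u * (l ^ k * iteratedDeriv k f (l * x))) • d := by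
  have hk : ContDiff ℝ k f := hf.of_le (by exact_mod_cast le_top)
  have h1 : ContDiff ℝ k fun t => f (l * t) := hk.comp (contDiff_const.mul contDiff_id)
  rw [iteratedDeriv_smul_const (contDiff_const.mul h1).contDiffAt,
    iteratedDeriv_const_mul _ h1.contDiffAt, iteratedDeriv_comp_const_mul hk]

/-- **Borel's lemma**: every sequence is the sequence of derivatives at `a` of a smooth map. -/
theorem exists_contDiff_iteratedDeriv_eq {E : Type*} [NormedAddCommGroup E] [NormedSpace ℝ E]
    [CompleteSpace E] (c : ℕ → E) (a : ℝ) :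
    ∃ h : ℝ → E, ContDiff ℝ ∞ h ∧ ∀ k, iteratedDeriv k h a = c k := by
  suffices H : ∃ h : ℝ → E, ContDiff ℝ ∞ h ∧ ∀ k, iteratedDeriv k h 0 = c k by
    obtain ⟨h, hh, hc⟩ := H
    refine ⟨fun t => h (t - a), hh.comp (contDiff_id.sub contDiff_const), fun k => ?_⟩
    rw [iteratedDeriv_comp_sub_const]
    simpa using hc k
  let χ : ContDiffBump (0 : ℝ) := ⟨1, 2, one_pos, one_lt_two⟩
  let φ : ℕ → ℝ → ℝ := fun n t => χ t * t ^ n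
  have hφ : ∀ n, ContDiff ℝ ∞ (φ n) := fun n => χ.contDiff.mul (contDiff_id.pow n)
  have hφs : ∀ n, HasCompactSupport (φ n) := fun n => χ.hasCompactSupport.mul_right
  choose C hC using fun n => exists_iteratedDeriv_bound (hφ n) (hφs n)
  have hC0 : ∀ n k, 0 ≤ C n k := fun n k => (norm_nonneg _).trans (hC n k 0)
  let d : ℕ → E := fun n => (n.factorial : ℝ)⁻¹ • c n
  -- Rescaling by `l n` multiplies the k-th derivative of the n-th term by `l n ^ k * (l n)⁻¹ ^ n`,
  -- which is at most `(l n)⁻¹` for k < n. This choice makes all derivatives of order below n at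
  -- most `(1 / 2) ^ n` at once.
  let l : ℕ → ℝ := fun n => 1 + 2 ^ n * (∑ k ∈ Finset.range n, C n k) * ‖d n‖
  have hl : ∀ n, 1 ≤ l n := fun n => by
    have := Finset.sum_nonneg fun k (_ : k ∈ Finset.range n) => hC0 n k
    simp only [l, le_add_iff_nonneg_right]
    positivity
  have hl0 : ∀ n, 0 < l n := fun n => one_pos.trans_le (hl n)
  let f : ℕ → ℝ → E := fun n t => ((l n)⁻¹ ^ n * φ n (l n * t)) • d n
  have hf : ∀ n, ContDiff ℝ ∞ (f n) := fun n =>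
    (contDiff_const.mul ((hφ n).comp (contDiff_const.mul contDiff_id))).smul contDiff_const
  -- For fixed k only the finitely many n ≤ k fall in the second branch, so summability is that of
  -- the geometric series.
  let v : ℕ → ℕ → ℝ := fun k n =>
    if k < n then (1 / 2) ^ n else (l n)⁻¹ ^ n * (l n ^ k * C n k) * ‖d n‖
  have hv : ∀ k, Summable (v k) := fun k => by
    refine Summable.of_norm_bounded_eventually_nat summable_geometric_two ?_
    filter_upwards [Filter.eventually_gt_atTop k] with n hn
    simp [v, hn]
  have hb : ∀ k n x, ‖iteratedFDeriv ℝ k (f n) x‖ ≤ v k n := by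
    intro k n x
    have hl' := hl0 n
    have h1 : ‖iteratedFDeriv ℝ k (f n) x‖ ≤ (l n)⁻¹ ^ n * (l n ^ k * C n k) * ‖d n‖ := by
      rw [norm_iteratedFDeriv_eq_norm_iteratedDeriv, iteratedDeriv_smul_comp_mul (hφ n), norm_smul,
        norm_mul, norm_mul, Real.norm_of_nonneg (show 0 ≤ (l n)⁻¹ ^ n by positivity),
        Real.norm_of_nonneg (show 0 ≤ l n ^ k by positivity)]
      gcongr
      exact hC n k _
    by_cases hk : k < n
    · simp only [v, if_pos hk]
      refine h1.trans ?_
      have h2 : (l n)⁻¹ ^ n * l n ^ k ≤ (l n)⁻¹ := by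
        rw [inv_pow, ← div_eq_inv_mul, div_le_iff₀ (by positivity)]
        calc l n ^ k ≤ l n ^ (n - 1) := pow_le_pow_right₀ (hl n) (by omega)
          _ = (l n)⁻¹ * l n ^ n := by
            rw [← mul_pow_sub_one (by omega : n ≠ 0) (l n), inv_mul_cancel_left₀ hl'.ne']
      have h3 : C n k ≤ ∑ k ∈ Finset.range n, C n k :=
        Finset.single_le_sum (f := fun k => C n k) (fun k _ => hC0 n k) (Finset.mem_range.2 hk)
      calc (l n)⁻¹ ^ n * (l n ^ k * C n k) * ‖d n‖
          = ((l n)⁻¹ ^ n * l n ^ k) * (C n k * ‖d n‖) := by ring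
        _ ≤ (l n)⁻¹ * ((∑ k ∈ Finset.range n, C n k) * ‖d n‖) := by
          have := hC0 n k
          gcongr
        _ ≤ (1 / 2) ^ n := by
          rw [inv_mul_le_iff₀ hl', one_div, inv_pow, ← div_eq_mul_inv, le_div_iff₀ (by positivity)]
          simp only [l]
          linarith
    · simpa only [v, if_neg hk] using h1
  refine ⟨fun t => ∑' n, f n t, contDiff_tsum (N := ⊤) hf (fun k _ => hv k)
    (fun k n x _ => hb k n x), fun k => ?_⟩
  have h0 : ∀ n, iteratedDeriv k (f n) 0 = if k = n then c k else 0 := by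
    intro n
    -- Near 0 the bump equals 1 and the rescaling cancels, so the n-th term is the monomial `t ^ n •
    -- d n`, which contributes only to the derivative of order n.
    have he : f n =ᶠ[nhds 0] fun t => t ^ n • d n := by
      filter_upwards [Metric.ball_mem_nhds (0 : ℝ) (inv_pos.2 (hl0 n))] with t ht
      have hl' := hl0 n
      have : χ (l n * t) = 1 := by
        refine χ.one_of_mem_closedBall ?_
        rw [mem_ball_zero_iff] at ht
        rw [mem_closedBall_zero_iff, norm_mul, Real.norm_of_nonneg hl'.le]
        calc l n * ‖t‖ ≤ l n * (l n)⁻¹ := by gcongr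
          _ = 1 := mul_inv_cancel₀ hl'.ne'
      simp only [f, φ, this, one_mul, mul_pow]
      rw [← mul_assoc, ← mul_pow, inv_mul_cancel₀ hl'.ne', one_pow, one_mul]
    rw [he.iteratedDeriv_eq, iteratedDeriv_smul_const (contDiff_id.pow n).contDiffAt]
    have := iteratedDeriv_fun_pow_zero (𝕜 := ℝ) (n := k) (m := n)
    simp only [this]
    split_ifs with h
    · subst h
      simp only [d, smul_smul]
      rw [mul_inv_cancel₀ (by exact_mod_cast k.factorial_ne_zero), one_smul]
    · simp
  rw [iteratedDeriv_eq_iteratedFDeriv, iteratedFDeriv_tsum_apply (N := ⊤) hf (fun k _ => hv k)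
    (fun k n x _ => hb k n x) (by exact_mod_cast le_top), tsum_eq_single k,
    ← iteratedDeriv_eq_iteratedFDeriv, h0, if_pos rfl]
  intro n hn
  rw [← norm_eq_zero, norm_iteratedFDeriv_eq_norm_iteratedDeriv, h0, if_neg hn.symm, norm_zero]

/-- At a point outside one of the two sets, closedness keeps that set away from the point, so its
derivative condition there is vacuous. -/
theorem HasFTaylorSeriesUpToOn.union_of_isClosed {E F : Type*} [NormedAddCommGroup E]
    [NormedSpace ℝ E] [NormedAddCommGroup F] [NormedSpace ℝ F] {n : ℕ∞ω} {f : E → F}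
    {p : E → FormalMultilinearSeries ℝ E F} {s t : Set E} (hs : HasFTaylorSeriesUpToOn n f p s)
    (ht : HasFTaylorSeriesUpToOn n f p t) (hsc : IsClosed s) (htc : IsClosed t) :
    HasFTaylorSeriesUpToOn n f p (s ∪ t) where
  zero_eq x hx := hx.elim (hs.zero_eq x) (ht.zero_eq x)
  fderivWithin m hm x _ := by
    refine HasFDerivWithinAt.union ?_ ?_
    · by_cases h : x ∈ s
      · exact hs.fderivWithin m hm x h
      · exact .of_notMem_closure (by rwa [hsc.closure_eq])
    · by_cases h : x ∈ t
      · exact ht.fderivWithin m hm x h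
      · exact .of_notMem_closure (by rwa [htc.closure_eq])
  cont m hm := (hs.cont m hm).union_of_isClosed (ht.cont m hm) hsc htc

/-- Two `C^r` maps on closed sets with one common point, at which their jets agree, fit together. -/
theorem ContDiffOn.exists_glue {E F : Type*} [NormedAddCommGroup E] [NormedSpace ℝ E]
    [NormedAddCommGroup F] [NormedSpace ℝ F] {r : ℕ∞} {f g : E → F} {s t : Set E} {a : E}
    (hf : ContDiffOn ℝ r f s) (hg : ContDiffOn ℝ r g t) (hs : UniqueDiffOn ℝ s)
    (ht : UniqueDiffOn ℝ t) (hsc : IsClosed s) (htc : IsClosed t) (hst : s ∩ t ⊆ {a})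
    (h : ∀ k : ℕ, (k : ℕ∞ω) ≤ r → iteratedFDerivWithin ℝ k f s a = iteratedFDerivWithin ℝ k g t a) :
    ∃ F, ContDiffOn ℝ r F (s ∪ t) ∧ Set.EqOn F f s := by
  classical
  have hfg : ∀ x ∈ t, x ∈ s → ∀ k : ℕ, (k : ℕ∞ω) ≤ r →
      ftaylorSeriesWithin ℝ f s x k = ftaylorSeriesWithin ℝ g t x k := by
    intro x hxt hxs k hk
    obtain rfl : x = a := hst ⟨hxs, hxt⟩
    exact h k hk
  have hF := hf.ftaylorSeriesWithin hs
  have hG := hg.ftaylorSeriesWithin ht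
  refine ⟨s.piecewise f g, ?_, s.piecewise_eqOn f g⟩
  refine HasFTaylorSeriesUpToOn.contDiffOn
    (f' := s.piecewise (ftaylorSeriesWithin ℝ f s) (ftaylorSeriesWithin ℝ g t))
    (HasFTaylorSeriesUpToOn.union_of_isClosed ?_ ?_ hsc htc)
  · refine (hF.congr (s.piecewise_eqOn f g)).congr_series fun k hk x hx => ?_
    simp [Set.piecewise_eq_of_mem _ _ _ hx]
  · refine (hG.congr fun x hx => ?_).congr_series fun k hk x hx => ?_
    · by_cases hxs : x ∈ s
      · rw [Set.piecewise_eq_of_mem _ _ _ hxs, ← hF.zero_eq x hxs, ← hG.zero_eq x hx,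
          hfg x hx hxs 0 (by simp)]
      · rw [Set.piecewise_eq_of_notMem _ _ _ hxs]
    · by_cases hxs : x ∈ s
      · simp [Set.piecewise_eq_of_mem _ _ _ hxs, hfg x hx hxs k hk]
      · simp [Set.piecewise_eq_of_notMem _ _ _ hxs]

/-- Borel's lemma supplies a smooth map with the jet of `f` at `a`, to be used on `t`. For finite r
the prescribed derivatives of order above r carry no information, and gluing never compares them. -/
theorem ContDiffOn.exists_extension_union {E : Type*} [NormedAddCommGroup E] [NormedSpace ℝ E]
    [CompleteSpace E] {r : ℕ∞} {f : ℝ → E} {s t : Set ℝ} {a : ℝ} (hf : ContDiffOn ℝ r f s)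
    (hs : UniqueDiffOn ℝ s) (ht : UniqueDiffOn ℝ t) (hsc : IsClosed s) (htc : IsClosed t)
    (hst : s ∩ t ⊆ {a}) (hat : a ∈ t) :
    ∃ F, ContDiffOn ℝ r F (s ∪ t) ∧ Set.EqOn F f s := by
  obtain ⟨g, hg, hgk⟩ := exists_contDiff_iteratedDeriv_eq (fun k => iteratedDerivWithin k f s a) a
  have hgr : ContDiff ℝ r g := hg.of_le (by exact_mod_cast le_top)
  refine hf.exists_glue hgr.contDiffOn hs ht hsc htc hst fun k hk => ?_
  rw [iteratedFDerivWithin_eq_iteratedFDeriv ht (hgr.of_le hk).contDiffAt hat,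
    iteratedFDerivWithin_eq_equiv_comp, iteratedFDeriv_eq_equiv_comp, Function.comp_apply,
    Function.comp_apply, hgk]

/-- A `C^r` map on a compact interval extends to a `C^r` map on the line. -/
theorem ContDiffOn.exists_contDiff_extension_Icc {E : Type*} [NormedAddCommGroup E]
    [NormedSpace ℝ E] [CompleteSpace E] {r : ℕ∞} {f : ℝ → E} {a b : ℝ} (hab : a < b)
    (hf : ContDiffOn ℝ r f (Set.Icc a b)) :
    ∃ F, ContDiff ℝ r F ∧ Set.EqOn F f (Set.Icc a b) := by
  obtain ⟨g, hg, hgf⟩ := hf.exists_extension_union (t := Set.Iic a) (a := a) (uniqueDiffOn_Icc hab)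
    (uniqueDiffOn_Iic a) isClosed_Icc isClosed_Iic
    (fun x hx => le_antisymm hx.2 hx.1.1) Set.self_mem_Iic
  rw [Set.union_comm, Set.Iic_union_Icc_eq_Iic hab.le] at hg
  obtain ⟨F, hF, hFg⟩ := hg.exists_extension_union (t := Set.Ici b) (a := b) (uniqueDiffOn_Iic b)
    (uniqueDiffOn_Ici b) isClosed_Iic isClosed_Ici (fun x hx => le_antisymm hx.1 hx.2)
    Set.self_mem_Ici
  rw [Set.Iic_union_Ici, contDiffOn_univ] at hF
  exact ⟨F, hF, fun x hx => (hFg hx.2).trans (hgf hx)⟩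

theorem two_mod_add_three (m : ℕ) : 2 % (m + 3) = 2 := Nat.mod_eq_of_lt (by omega)

/-! The scaling map. -/

theorem scalingMap_isDiffeo (m : ℕ) {c : ℝ} (hc : 0 < c) : IsDiffeo (scalingMap m c) := by
  refine ⟨?_, fun x i => if i = 0 then (c ^ 2)⁻¹ * x i else c⁻¹ * x i, ?_, fun x => ?_, fun x => ?_⟩
  · rw [contDiff_pi]
    intro i
    unfold scalingMap
    split_ifs <;> fun_prop
  · rw [contDiff_pi]
    intro i
    split_ifs <;> fun_prop
  · ext i
    by_cases h : i = 0 <;> simp [scalingMap, h, hc.ne']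
  · ext i
    by_cases h : i = 0 <;> simp [scalingMap, h, hc.ne']

theorem fderiv_scalingMap_single (m : ℕ) (c : ℝ) (x : Fin (m + 3) → ℝ) (i : Fin (m + 3)) :
    fderiv ℝ (scalingMap m c) x (Pi.single i 1) =
      Pi.single i (if i = 0 then c ^ 2 else c) := by
  have h : HasFDerivAt (scalingMap m c) (ContinuousLinearMap.pi fun j : Fin (m + 3) =>
      (if j = 0 then c ^ 2 else c) •
        ContinuousLinearMap.proj (R := ℝ) (φ := fun _ : Fin (m + 3) => ℝ) j) x := by
    rw [hasFDerivAt_pi]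
    intro j
    unfold scalingMap
    split_ifs
    · exact (hasFDerivAt_apply j x).const_mul _
    · exact (hasFDerivAt_apply j x).const_mul _
  rw [h.fderiv]
  ext j
  simp only [ContinuousLinearMap.coe_pi', smul_apply,
    ContinuousLinearMap.proj_apply, smul_eq_mul, Pi.single_apply]
  by_cases hj : j = i
  · subst hj; simp
  · simp [hj]

theorem metricForm_single {N : ℕ} (g : MetricField N) (x : Fin N → ℝ) (i j : Fin N) (a b : ℝ) :
    metricForm g x (Pi.single i a) (Pi.single j b) = a * b * g x i j := by
  simp [metricForm, Matrix.mulVec_single, single_dotProduct]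
  ring

/-- Under the scaling θ is multiplied by c² and each dx_i with i ≥ 1 by c, so -θ² + ∑ dx_i² becomes
c²(-c²θ² + ∑ dx_i²). -/
theorem pullbackMetric_scalingMap (m : ℕ) (c : ℝ) :
    pullbackMetric (scalingMap m c) (explicitMetric m 1) = c ^ 2 • explicitMetric m c := by
  have h10 : (1 : Fin (m + 3)) ≠ 0 := by simp
  have h20 : (2 : Fin (m + 3)) ≠ 0 := by simp [Fin.ext_iff, two_mod_add_three]
  have hω : ∀ (x : Fin (m + 3) → ℝ) i, (if i = 0 then c ^ 2 else c) * twistForm (scalingMap m c x) i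
      = c ^ 2 * twistForm x i := by
    intro x i
    unfold twistForm scalingMap
    by_cases h0 : i = 0
    · simp [h0]
    · by_cases h1 : i = 1
      · simp [h1, h20]; ring
      · simp [h0, h1]
  funext x
  ext i j
  simp only [pullbackMetric, fderiv_scalingMap_single, metricForm_single, explicitMetric,
    Matrix.of_apply, Pi.smul_apply, Matrix.smul_apply, smul_eq_mul]
  have hd : (if i = 0 then c ^ 2 else c) * (if j = 0 then c ^ 2 else c) *
      (if i = j ∧ i ≠ 0 then (1 : ℝ) else 0) = c ^ 2 * if i = j ∧ i ≠ 0 then (1 : ℝ) else 0 := by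
    by_cases h : i = j ∧ i ≠ 0
    · have hj : j ≠ 0 := h.1 ▸ h.2
      simp only [if_pos h, if_neg h.2, if_neg hj]
      ring
    · simp [h]
  have hωω := congrArg₂ (· * ·) (hω x i) (hω x j)
  linear_combination hd - hωω

theorem explicitMetric_scaling (m : ℕ) {c : ℝ} (hc : 0 < c) :
    explicitMetric m c = (1 / c ^ 2) • pullbackMetric (scalingMap m c) (explicitMetric m 1) := by
  rw [pullbackMetric_scalingMap, smul_smul, one_div_mul_cancel (by positivity), one_smul]

/-! The Levi-Civita connection and the Ricci tensor. -/

/-- A real-valued symbol in place of case distinctions: tensor components become polynomials in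
deltas and `x 2`, and their identities are accessible to `ring`. -/
def kroneckerDelta {N : ℕ} (i j : Fin N) : ℝ := if i = j then 1 else 0

local notation "δ" => kroneckerDelta

theorem kroneckerDelta_self {N : ℕ} (i : Fin N) : δ i i = 1 := by simp [kroneckerDelta]

theorem kroneckerDelta_of_ne {N : ℕ} {i j : Fin N} (h : i ≠ j) : δ i j = 0 := by
  simp [kroneckerDelta, h]

theorem sum_kroneckerDelta_mul {N : ℕ} (a : Fin N) (f : Fin N → ℝ) : ∑ i, δ i a * f i = f a := by
  simp [kroneckerDelta]

theorem twistForm_eq {m : ℕ} (x : Fin (m + 3) → ℝ) (i : Fin (m + 3)) :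
    twistForm x i = δ i 0 + x 2 * δ i 1 := by
  unfold twistForm kroneckerDelta
  by_cases h0 : i = 0
  · simp [h0]
  · simp [h0]

theorem explicitMetric_apply (m : ℕ) (c : ℝ) (x : Fin (m + 3) → ℝ) (i j : Fin (m + 3)) :
    explicitMetric m c x i j =
      δ i j - δ i 0 * δ j 0 - c ^ 2 * (δ i 0 + x 2 * δ i 1) * (δ j 0 + x 2 * δ j 1) := by
  have : (if i = j ∧ i ≠ 0 then (1 : ℝ) else 0) = δ i j - δ i 0 * δ j 0 := by
    unfold kroneckerDelta
    by_cases h : i = j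
    · subst h; by_cases h0 : i = 0 <;> simp [h0]
    · by_cases h0 : i = 0
      · subst h0; simp [h, Ne.symm h]
      · simp [h, h0]
  simp only [explicitMetric, Matrix.of_apply, twistForm_eq, this]

theorem partialDeriv_comp_apply {N : ℕ} {f : ℝ → ℝ} {f' : ℝ} {x : Fin N → ℝ} (j k : Fin N)
    (h : HasDerivAt f f' (x j)) : partialDeriv k (fun y => f (y j)) x = δ k j * f' := by
  have := h.comp_hasFDerivAt x (hasFDerivAt_apply (𝕜 := ℝ) (F' := fun _ => ℝ) j x)
  have h2 : HasFDerivAt (fun y : Fin N → ℝ => f (y j))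
    (f' • ContinuousLinearMap.proj (R := ℝ) (φ := fun _ : Fin N => ℝ) j) x := this
  rw [partialDeriv, h2.fderiv]
  simp [kroneckerDelta, Pi.single_apply, mul_comm, eq_comm]

/-- The only differentiation rule that the curvature needs: metric components and Christoffel
symbols are quadratic polynomials in the single coordinate x_2. -/
theorem partialDeriv_quadratic {N : ℕ} (x : Fin N → ℝ) (j k : Fin N) (a b d : ℝ) :
    partialDeriv k (fun y => a + b * y j + d * y j ^ 2) x = δ k j * (b + 2 * d * x j) := by
  refine partialDeriv_comp_apply (f := fun s => a + b * s + d * s ^ 2) j k ?_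
  have := (((hasDerivAt_id (x j)).const_mul b).const_add a).add
    (((hasDerivAt_id (x j)).pow 2).const_mul d)
  refine (this.congr_deriv ?_).congr_of_eventuallyEq (Filter.Eventually.of_forall fun s => ?_)
  · simp; ring
  · simp

theorem partialDeriv_explicitMetric (m : ℕ) (c : ℝ) (x : Fin (m + 3) → ℝ) (k i j : Fin (m + 3)) :
    partialDeriv k (fun y => explicitMetric m c y i j) x =
      -c ^ 2 * δ k 2 * (δ i 1 * (δ j 0 + x 2 * δ j 1) + (δ i 0 + x 2 * δ i 1) * δ j 1) := by
  have h : (fun y => explicitMetric m c y i j) = fun y : Fin (m + 3) → ℝ =>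
      (δ i j - δ i 0 * δ j 0 - c ^ 2 * δ i 0 * δ j 0) +
        (-c ^ 2 * (δ i 0 * δ j 1 + δ i 1 * δ j 0)) * y 2 + (-c ^ 2 * δ i 1 * δ j 1) * y 2 ^ 2 := by
    funext y
    rw [explicitMetric_apply]
    ring
  rw [h, partialDeriv_quadratic]
  ring

/-- Read off from the orthonormal frame: g⁻¹ = -e_0 ⊗ e_0 + ∑_{i ≥ 1} e_i ⊗ e_i. -/
def explicitInverse (m : ℕ) (c : ℝ) : MetricField (m + 3) :=
  fun x => Matrix.of fun k l => δ k l - δ k 0 * δ l 0 - (1 / c ^ 2) * δ k 0 * δ l 0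
    - x 2 * (δ k 0 * δ l 1 + δ k 1 * δ l 0) + x 2 ^ 2 * δ k 0 * δ l 0

theorem kroneckerDelta_comm {N : ℕ} (i j : Fin N) : δ i j = δ j i := by
  simp [kroneckerDelta, eq_comm]

theorem delta_10 (m : ℕ) : δ (1 : Fin (m + 3)) 0 = 0 := kroneckerDelta_of_ne (by simp)
theorem delta_01 (m : ℕ) : δ (0 : Fin (m + 3)) 1 = 0 := kroneckerDelta_of_ne (by simp)
theorem delta_20 (m : ℕ) : δ (2 : Fin (m + 3)) 0 = 0 :=
  kroneckerDelta_of_ne (by simp [Fin.ext_iff, two_mod_add_three])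
theorem delta_02 (m : ℕ) : δ (0 : Fin (m + 3)) 2 = 0 :=
  kroneckerDelta_of_ne (by simp [Fin.ext_iff, two_mod_add_three])
theorem delta_21 (m : ℕ) : δ (2 : Fin (m + 3)) 1 = 0 :=
  kroneckerDelta_of_ne (by simp [Fin.ext_iff, two_mod_add_three])
theorem delta_12 (m : ℕ) : δ (1 : Fin (m + 3)) 2 = 0 :=
  kroneckerDelta_of_ne (by simp [Fin.ext_iff, two_mod_add_three])

/-- The vector `(g^c)^{-1}` applied to a covector. -/
theorem sum_explicitInverse_mul (m : ℕ) (c : ℝ) (x u : Fin (m + 3) → ℝ) (k : Fin (m + 3)) :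
    ∑ l, explicitInverse m c x k l * u l = u k - δ k 0 * u 0 - (1 / c ^ 2) * δ k 0 * u 0
      - x 2 * (δ k 0 * u 1 + δ k 1 * u 0) + x 2 ^ 2 * δ k 0 * u 0 := by
  have h : ∀ l, explicitInverse m c x k l * u l = δ l k * u l +
      (δ l 0 * u l) * (-δ k 0 - (1 / c ^ 2) * δ k 0 - x 2 * δ k 1 + x 2 ^ 2 * δ k 0)
      + (δ l 1 * u l) * (-x 2 * δ k 0) := by
    intro l
    simp only [explicitInverse, Matrix.of_apply, kroneckerDelta_comm l k]
    ring
  simp_rw [h, Finset.sum_add_distrib, ← Finset.sum_mul, sum_kroneckerDelta_mul]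
  ring

theorem explicitMetric_inv (m : ℕ) {c : ℝ} (hc : 0 < c) (x : Fin (m + 3) → ℝ) :
    (explicitMetric m c x)⁻¹ = explicitInverse m c x := by
  refine Matrix.inv_eq_left_inv ?_
  ext k j
  rw [Matrix.mul_apply, sum_explicitInverse_mul]
  simp only [explicitMetric_apply, kroneckerDelta_self, delta_10, delta_01, Matrix.one_apply,
    kroneckerDelta_comm 0 j, kroneckerDelta_comm 1 j]
  change _ = δ k j
  field_simp
  ring

theorem christoffel_explicitMetric (m : ℕ) {c : ℝ} (hc : 0 < c) (x : Fin (m + 3) → ℝ)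
    (k i j : Fin (m + 3)) :
    christoffel (explicitMetric m c) k i j x =
      (1 / 2) * δ k 0 * (δ i 2 * δ j 1 + δ j 2 * δ i 1)
      - c ^ 2 / 2 * (δ k 1 - x 2 * δ k 0) *
        (δ i 2 * (δ j 0 + x 2 * δ j 1) + δ j 2 * (δ i 0 + x 2 * δ i 1))
      + c ^ 2 / 2 * δ k 2 *
        (δ i 1 * (δ j 0 + x 2 * δ j 1) + δ j 1 * (δ i 0 + x 2 * δ i 1)) := by
  rw [christoffel, explicitMetric_inv m hc, sum_explicitInverse_mul]
  simp only [partialDeriv_explicitMetric, kroneckerDelta_self, delta_10, delta_01, delta_02,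
    delta_12]
  field_simp
  ring

theorem partialDeriv_christoffel (m : ℕ) {c : ℝ} (hc : 0 < c) (x : Fin (m + 3) → ℝ)
    (p k i j : Fin (m + 3)) :
    partialDeriv p (christoffel (explicitMetric m c) k i j) x = δ p 2 *
      (c ^ 2 / 2 * δ k 0 * (δ i 2 * (δ j 0 + x 2 * δ j 1) + δ j 2 * (δ i 0 + x 2 * δ i 1))
      - c ^ 2 / 2 * (δ k 1 - x 2 * δ k 0) * (δ i 2 * δ j 1 + δ j 2 * δ i 1)
      + c ^ 2 * δ k 2 * δ i 1 * δ j 1) := by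
  have h : christoffel (explicitMetric m c) k i j = fun y : Fin (m + 3) → ℝ =>
      ((1 / 2) * δ k 0 * (δ i 2 * δ j 1 + δ j 2 * δ i 1)
        - c ^ 2 / 2 * δ k 1 * (δ i 2 * δ j 0 + δ j 2 * δ i 0)
        + c ^ 2 / 2 * δ k 2 * (δ i 1 * δ j 0 + δ j 1 * δ i 0)) +
      (c ^ 2 / 2 * δ k 0 * (δ i 2 * δ j 0 + δ j 2 * δ i 0)
        - c ^ 2 / 2 * δ k 1 * (δ i 2 * δ j 1 + δ j 2 * δ i 1)
        + c ^ 2 * δ k 2 * δ i 1 * δ j 1) * y 2 +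
      (c ^ 2 / 2 * δ k 0 * (δ i 2 * δ j 1 + δ j 2 * δ i 1)) * y 2 ^ 2 := by
    funext y
    rw [christoffel_explicitMetric m hc]
    ring
  rw [h, partialDeriv_quadratic]
  ring

theorem succ_succ_succ_ne {m : ℕ} (i : Fin m) : (i.succ.succ.succ : Fin (m + 3)) ≠ 0 ∧
    (i.succ.succ.succ : Fin (m + 3)) ≠ 1 ∧ (i.succ.succ.succ : Fin (m + 3)) ≠ 2 := by
  have h2 : ((2 : Fin (m + 3)) : ℕ) = 2 := two_mod_add_three m
  have h1 : ((1 : Fin (m + 3)) : ℕ) = 1 := by simp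
  refine ⟨Fin.succ_ne_zero _, fun h => ?_, fun h => ?_⟩ <;>
    · have := congrArg Fin.val h
      simp only [Fin.val_succ] at this
      omega

/-- Reduces the contractions in dimension m + 3 to the indices 0, 1, 2; the remaining flat
directions contribute nothing. -/
theorem sum_eq_three {m : ℕ} {f : Fin (m + 3) → ℝ}
    (h : ∀ i, i ≠ 0 → i ≠ 1 → i ≠ 2 → f i = 0) : ∑ i, f i = f 0 + f 1 + f 2 := by
  rw [Fin.sum_univ_succ, Fin.sum_univ_succ, Fin.sum_univ_succ, Finset.sum_eq_zero]
  · simp only [Fin.succ_zero_eq_one, Fin.succ_one_eq_two]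
    ring
  · intro i _
    obtain ⟨h0, h1, h2⟩ := succ_succ_succ_ne i
    exact h _ h0 h1 h2

theorem ricci_explicitMetric (m : ℕ) {c : ℝ} (hc : 0 < c) (x : Fin (m + 3) → ℝ)
    (j k : Fin (m + 3)) :
    ricci (explicitMetric m c) x j k = c ^ 2 / 2 * (δ j 1 * δ k 1 + δ j 2 * δ k 2)
      + c ^ 4 / 2 * (δ j 0 + x 2 * δ j 1) * (δ k 0 + x 2 * δ k 1) := by
  simp only [ricci, Matrix.of_apply, riemannCurv, partialDeriv_christoffel m hc]
  rw [sum_eq_three]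
  · rw [sum_eq_three, sum_eq_three, sum_eq_three]
    · simp only [christoffel_explicitMetric m hc, kroneckerDelta_self, delta_10, delta_01, delta_20,
        delta_02, delta_21, delta_12]
      ring
    all_goals
      intro p h0 h1 h2
      simp only [christoffel_explicitMetric m hc, kroneckerDelta_of_ne h0, kroneckerDelta_of_ne h1,
        kroneckerDelta_of_ne h2]
      ring
  · intro i h0 h1 h2
    rw [Finset.sum_eq_zero]
    · simp only [kroneckerDelta_of_ne h0, kroneckerDelta_of_ne h1, kroneckerDelta_of_ne h2]
      ring
    · intro p _
      simp only [christoffel_explicitMetric m hc, kroneckerDelta_of_ne h0, kroneckerDelta_of_ne h1,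
        kroneckerDelta_of_ne h2]
      ring

theorem scalarCurv_explicitMetric (m : ℕ) {c : ℝ} (hc : 0 < c) (x : Fin (m + 3) → ℝ) :
    scalarCurv (explicitMetric m c) x = c ^ 2 / 2 := by
  rw [scalarCurv, explicitMetric_inv m hc]
  simp_rw [sum_explicitInverse_mul, ricci_explicitMetric m hc, kroneckerDelta_self, delta_10,
    delta_01, delta_02, delta_12]
  rw [sum_eq_three]
  · simp only [kroneckerDelta_self, delta_10, delta_01, delta_20, delta_02, delta_21, delta_12]
    field_simp
    ring
  · intro i h0 h1 h2
    simp only [kroneckerDelta_of_ne h0, kroneckerDelta_of_ne h1, kroneckerDelta_of_ne h2]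
    ring

theorem metricForm_ricci (m : ℕ) {c : ℝ} (hc : 0 < c) (x v w : Fin (m + 3) → ℝ) :
    metricForm (ricci (explicitMetric m c)) x v w = c ^ 2 / 2 * (v 1 * w 1 + v 2 * w 2) +
      c ^ 4 / 2 * (v 0 + x 2 * v 1) * (w 0 + x 2 * w 1) := by
  have h : ∀ i, ∑ j, ricci (explicitMetric m c) x i j * w j =
      c ^ 2 / 2 * (δ i 1 * w 1 + δ i 2 * w 2)
        + c ^ 4 / 2 * (δ i 0 + x 2 * δ i 1) * (w 0 + x 2 * w 1) := by
    intro i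
    have : ∀ j, ricci (explicitMetric m c) x i j * w j =
      (δ j 0 * w j) * (c ^ 4 / 2 * (δ i 0 + x 2 * δ i 1))
      + (δ j 1 * w j) * (c ^ 2 / 2 * δ i 1 + c ^ 4 / 2 * (δ i 0 + x 2 * δ i 1) * x 2)
      + (δ j 2 * w j) * (c ^ 2 / 2 * δ i 2) := by
      intro j
      rw [ricci_explicitMetric m hc]
      ring
    simp_rw [this, Finset.sum_add_distrib, ← Finset.sum_mul, sum_kroneckerDelta_mul]
    ring
  simp only [metricForm, dotProduct, Matrix.mulVec, h]
  have : ∀ i, v i * (c ^ 2 / 2 * (δ i 1 * w 1 + δ i 2 * w 2)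
        + c ^ 4 / 2 * (δ i 0 + x 2 * δ i 1) * (w 0 + x 2 * w 1)) =
      (δ i 0 * v i) * (c ^ 4 / 2 * (w 0 + x 2 * w 1))
      + (δ i 1 * v i) * (c ^ 2 / 2 * w 1 + c ^ 4 / 2 * x 2 * (w 0 + x 2 * w 1))
      + (δ i 2 * v i) * (c ^ 2 / 2 * w 2) := by
    intro i
    ring
  simp_rw [this, Finset.sum_add_distrib, ← Finset.sum_mul, sum_kroneckerDelta_mul]
  ring

/-! ### Energy conditions. -/

theorem timelikeConvergence_explicitMetric (m : ℕ) {c : ℝ} (hc : 0 < c) :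
    TimelikeConvergence (explicitMetric m c) := by
  intro x v _
  rw [metricForm_ricci m hc]
  have : 0 ≤ c ^ 2 / 2 * (v 1 ^ 2 + v 2 ^ 2) + c ^ 4 / 2 * (v 0 + x 2 * v 1) ^ 2 := by positivity
  linarith

theorem metricForm_explicitMetric' {m : ℕ} (c : ℝ) (x v w : Fin (m + 3) → ℝ) :
    metricForm (explicitMetric m c) x v w =
      -c ^ 2 * (v 0 + x 2 * v 1) * (w 0 + x 2 * w 1) + v 1 * w 1 + v 2 * w 2
        + ∑ i : Fin m, v i.succ.succ.succ * w i.succ.succ.succ := by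
  rw [metricForm_explicitMetric, Fin.sum_univ_succ, Fin.sum_univ_succ]
  simp only [Fin.succ_zero_eq_one, Fin.succ_one_eq_two]
  ring

theorem energyMomentum_apply (m : ℕ) {c : ℝ} (hc : 0 < c) (Λ : ℝ) (x : Fin (m + 3) → ℝ)
    (i j : Fin (m + 3)) :
    energyMomentum (explicitMetric m c) Λ x i j = ricci (explicitMetric m c) x i j +
      (Λ - c ^ 2 / 4) * explicitMetric m c x i j := by
  simp only [energyMomentum, scalarCurv_explicitMetric m hc, Matrix.add_apply, Matrix.sub_apply,
    Matrix.smul_apply, smul_eq_mul]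
  ring

theorem metricForm_energyMomentum (m : ℕ) {c : ℝ} (hc : 0 < c) (Λ : ℝ)
    (x v w : Fin (m + 3) → ℝ) :
    metricForm (energyMomentum (explicitMetric m c) Λ) x v w =
      metricForm (ricci (explicitMetric m c)) x v w +
      (Λ - c ^ 2 / 4) * metricForm (explicitMetric m c) x v w := by
  have h : energyMomentum (explicitMetric m c) Λ x = ricci (explicitMetric m c) x +
      (Λ - c ^ 2 / 4) • explicitMetric m c x := by
    ext i j
    exact energyMomentum_apply m hc Λ x i j
  simp only [metricForm, h, Matrix.add_mulVec, Matrix.smul_mulVec, dotProduct_add,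
    dotProduct_smul, smul_eq_mul]

theorem vecMul_energyMomentum (m : ℕ) {c : ℝ} (hc : 0 < c) (Λ : ℝ) (x v : Fin (m + 3) → ℝ)
    (j : Fin (m + 3)) :
    (v ᵥ* energyMomentum (explicitMetric m c) Λ x) j =
      c ^ 2 / 2 * (δ j 1 * v 1 + δ j 2 * v 2)
      + c ^ 4 / 2 * (v 0 + x 2 * v 1) * (δ j 0 + x 2 * δ j 1)
      + (Λ - c ^ 2 / 4) * (v j - δ j 0 * v 0
        - c ^ 2 * (v 0 + x 2 * v 1) * (δ j 0 + x 2 * δ j 1)) := by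
  have h : ∀ i, v i * energyMomentum (explicitMetric m c) Λ x i j =
      (δ i 0 * v i) * (c ^ 4 / 2 * (δ j 0 + x 2 * δ j 1)
        - (Λ - c ^ 2 / 4) * (δ j 0 + c ^ 2 * (δ j 0 + x 2 * δ j 1)))
      + (δ i 1 * v i) * (c ^ 2 / 2 * δ j 1 + c ^ 4 / 2 * x 2 * (δ j 0 + x 2 * δ j 1)
        - (Λ - c ^ 2 / 4) * (c ^ 2 * x 2 * (δ j 0 + x 2 * δ j 1)))
      + (δ i 2 * v i) * (c ^ 2 / 2 * δ j 2) + (δ i j * v i) * (Λ - c ^ 2 / 4) := by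
    intro i
    rw [energyMomentum_apply m hc, ricci_explicitMetric m hc, explicitMetric_apply]
    ring
  simp only [Matrix.vecMul, dotProduct, h, Finset.sum_add_distrib, ← Finset.sum_mul,
    sum_kroneckerDelta_mul]
  ring

theorem sharpOf_energyMomentum (m : ℕ) {c : ℝ} (hc : 0 < c) (Λ : ℝ) (x v : Fin (m + 3) → ℝ)
    (k : Fin (m + 3)) :
    sharpOf (explicitMetric m c) (energyMomentum (explicitMetric m c) Λ) x v k =
      (Λ - c ^ 2 / 4) * v k + c ^ 2 / 2 * (v 1 * (δ k 1 - x 2 * δ k 0) + v 2 * δ k 2)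
      - c ^ 2 / 2 * (v 0 + x 2 * v 1) * δ k 0 := by
  rw [sharpOf, explicitMetric_inv m hc]
  simp only [Matrix.mulVec, dotProduct]
  rw [sum_explicitInverse_mul]
  simp only [vecMul_energyMomentum m hc, kroneckerDelta_self, delta_10, delta_01, delta_02,
    delta_12]
  field_simp
  ring

/-- Put μ = Λ - c²/4 ≤ 0. The endomorphism v ↦ ♯T(v, ·) is diagonal in the frame, with eigenvalue μ
- c²/2 on e_0, μ + c²/2 on e_1 and e_2, and μ on the rest. For μ ≤ 0 the first has the largest
absolute value, so a timelike vector is not made spacelike. -/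
theorem dominantEnergyCondition_explicitMetric (m : ℕ) {c : ℝ} (hc : 0 < c) {Λ : ℝ}
    (hΛ : Λ ≤ c ^ 2 / 4) : DominantEnergyCondition (explicitMetric m c) Λ := by
  refine ⟨fun x v hv => ?_, fun x v hv => ?_⟩
  · have h1 := timelikeConvergence_explicitMetric m hc x v hv
    rw [metricForm_energyMomentum m hc]
    have h2 := mul_nonneg_of_nonpos_of_nonpos (sub_nonpos.2 hΛ) (le_of_lt hv)
    linarith
  · have hs : ∀ i : Fin m, sharpOf (explicitMetric m c) (energyMomentum (explicitMetric m c) Λ) x v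
        i.succ.succ.succ = (Λ - c ^ 2 / 4) * v i.succ.succ.succ := by
      intro i
      obtain ⟨h0, h1, h2⟩ := succ_succ_succ_ne i
      rw [sharpOf_energyMomentum m hc, kroneckerDelta_of_ne h0, kroneckerDelta_of_ne h1,
        kroneckerDelta_of_ne h2]
      ring
    unfold IsTimelike at hv
    unfold IsSpacelike
    rw [metricForm_explicitMetric'] at hv ⊢
    simp only [Pi.neg_apply, hs]
    simp only [sharpOf_energyMomentum m hc, kroneckerDelta_self, delta_10, delta_01, delta_20,
      delta_02, delta_21, delta_12, neg_mul_neg]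
    set R := ∑ i : Fin m, v i.succ.succ.succ * v i.succ.succ.succ with hR
    have hR0 : 0 ≤ R := Finset.sum_nonneg fun i _ => mul_self_nonneg _
    have hS : ∑ i : Fin m, (Λ - c ^ 2 / 4) * v i.succ.succ.succ *
        ((Λ - c ^ 2 / 4) * v i.succ.succ.succ) = (Λ - c ^ 2 / 4) ^ 2 * R := by
      rw [hR, Finset.mul_sum]
      exact Finset.sum_congr rfl fun i _ => by ring
    rw [hS]
    set μ := Λ - c ^ 2 / 4
    have hμ : μ ≤ 0 := sub_nonpos.2 hΛ
    have hμc : 0 ≤ -μ * c ^ 2 := mul_nonneg (neg_nonneg.2 hμ) (sq_nonneg c)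
    have hμ2 : 0 ≤ (μ - c ^ 2 / 2) ^ 2 := sq_nonneg _
    -- Compare with (μ - c²/2)² g(v, v) ≤ 0. The differences of squared eigenvalues are -2μc² on
    -- e_1, e_2 (twice `e2`) and -μc² + c⁴/4 on the flat directions (`e3`).
    have e1 := mul_le_mul_of_nonneg_left hv.le hμ2
    have e2 : 0 ≤ -μ * c ^ 2 * (v 1 * v 1 + v 2 * v 2) :=
      mul_nonneg hμc (add_nonneg (mul_self_nonneg _) (mul_self_nonneg _))
    have e3 : 0 ≤ (-μ * c ^ 2 + c ^ 4 / 4) * R := mul_nonneg (by positivity) hR0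
    intro h
    nlinarith [e1, e2, e3, h]

/-! Geodesics. -/

/-- The right-hand side of the geodesic equation of `explicitMetric m c` at `x` with velocity `v`. -/
def geodesicAcceleration {m : ℕ} (c : ℝ) (x v : Fin (m + 3) → ℝ) (k : Fin (m + 3)) : ℝ :=
  c ^ 2 * (v 0 + x 2 * v 1) * (v 2 * (δ k 1 - x 2 * δ k 0) - v 1 * δ k 2) - v 1 * v 2 * δ k 0

theorem neg_sum_christoffel_explicitMetric (m : ℕ) {c : ℝ} (hc : 0 < c) (x v : Fin (m + 3) → ℝ)
    (k : Fin (m + 3)) :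
    -∑ i, ∑ j, christoffel (explicitMetric m c) k i j x * v i * v j =
      geodesicAcceleration c x v k := by
  rw [sum_eq_three]
  · rw [sum_eq_three, sum_eq_three, sum_eq_three]
    · simp only [christoffel_explicitMetric m hc, kroneckerDelta_self, delta_10, delta_01, delta_20,
        delta_02, delta_21, delta_12, geodesicAcceleration]
      ring
    all_goals
      intro p h0 h1 h2
      simp only [christoffel_explicitMetric m hc, kroneckerDelta_of_ne h0, kroneckerDelta_of_ne h1,
        kroneckerDelta_of_ne h2]
      ring
  · intro i h0 h1 h2
    refine Finset.sum_eq_zero fun p _ => ?_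
    simp only [christoffel_explicitMetric m hc, kroneckerDelta_of_ne h0, kroneckerDelta_of_ne h1,
      kroneckerDelta_of_ne h2]
    ring

theorem deriv_eq_of_hasDerivAt_apply {N : ℕ} {γ γ' : ℝ → Fin N → ℝ}
    (h : ∀ t k, HasDerivAt (fun s => γ s k) (γ' t k) t) : deriv γ = γ' :=
  funext fun t => (hasDerivAt_pi.2 fun k => h t k).deriv

theorem isGeodesic_of_hasDerivAt {m : ℕ} {c : ℝ} (hc : 0 < c) {γ γ' : ℝ → Fin (m + 3) → ℝ}
    (hγ : ContDiff ℝ ∞ γ) (h : ∀ t k, HasDerivAt (fun s => γ s k) (γ' t k) t)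
    (h' : ∀ t k, HasDerivAt (fun s => γ' s k) (geodesicAcceleration c (γ t) (γ' t) k) t) :
    IsGeodesic (explicitMetric m c) γ := by
  refine ⟨hγ, fun t k => ?_⟩
  rw [deriv_eq_of_hasDerivAt_apply h, neg_sum_christoffel_explicitMetric m hc,
    (hasDerivAt_pi.2 fun k => h' t k).deriv]

theorem IsGeodesic.hasDerivAt {m : ℕ} {c : ℝ} {γ : ℝ → Fin (m + 3) → ℝ}
    (h : IsGeodesic (explicitMetric m c) γ) (t : ℝ) (k : Fin (m + 3)) :
    HasDerivAt (fun s => γ s k) (deriv γ t k) t :=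
  hasDerivAt_pi.1 (h.1.differentiable (by simp) t).hasDerivAt k

theorem IsGeodesic.hasDerivAt_deriv {m : ℕ} {c : ℝ} (hc : 0 < c) {γ : ℝ → Fin (m + 3) → ℝ}
    (h : IsGeodesic (explicitMetric m c) γ) (t : ℝ) (k : Fin (m + 3)) :
    HasDerivAt (fun s => deriv γ s k) (geodesicAcceleration c (γ t) (deriv γ t) k) t := by
  rw [← neg_sum_christoffel_explicitMetric m hc, ← h.2 t k]
  have h1 : ContDiff ℝ ∞ (deriv γ) := (contDiff_infty_iff_deriv.1 h.1).2
  exact hasDerivAt_pi.1 (h1.differentiable (by simp) t).hasDerivAt k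

theorem geodesicAcceleration_zero {m : ℕ} (c : ℝ) (x v : Fin (m + 3) → ℝ) :
    geodesicAcceleration c x v 0 = -(c ^ 2 * (v 0 + x 2 * v 1)) * x 2 * v 2 - v 1 * v 2 := by
  simp only [geodesicAcceleration, kroneckerDelta_self, delta_01, delta_02]
  ring

theorem geodesicAcceleration_one {m : ℕ} (c : ℝ) (x v : Fin (m + 3) → ℝ) :
    geodesicAcceleration c x v 1 = c ^ 2 * (v 0 + x 2 * v 1) * v 2 := by
  simp only [geodesicAcceleration, kroneckerDelta_self, delta_10, delta_12]
  ring

theorem geodesicAcceleration_two {m : ℕ} (c : ℝ) (x v : Fin (m + 3) → ℝ) :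
    geodesicAcceleration c x v 2 = -(c ^ 2 * (v 0 + x 2 * v 1)) * v 1 := by
  simp only [geodesicAcceleration, kroneckerDelta_self, delta_20, delta_21]
  ring

theorem geodesicAcceleration_of_ne {m : ℕ} (c : ℝ) (x v : Fin (m + 3) → ℝ) {k : Fin (m + 3)}
    (h0 : k ≠ 0) (h1 : k ≠ 1) (h2 : k ≠ 2) : geodesicAcceleration c x v k = 0 := by
  simp only [geodesicAcceleration, kroneckerDelta_of_ne h0, kroneckerDelta_of_ne h1,
    kroneckerDelta_of_ne h2]
  ring

/-- The vector of `ℝ^(m + 3)` with components `a`, `b`, `d`, and `u i` for `i ≥ 3`. -/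
def vecOf {m : ℕ} (a b d : ℝ) (u : Fin (m + 3) → ℝ) (i : Fin (m + 3)) : ℝ :=
  if i = 0 then a else if i = 1 then b else if i = 2 then d else u i

theorem vecOf_zero {m : ℕ} (a b d : ℝ) (u : Fin (m + 3) → ℝ) : vecOf a b d u 0 = a := by
  simp [vecOf]

theorem vecOf_one {m : ℕ} (a b d : ℝ) (u : Fin (m + 3) → ℝ) : vecOf a b d u 1 = b := by
  simp [vecOf]

theorem vecOf_two {m : ℕ} (a b d : ℝ) (u : Fin (m + 3) → ℝ) : vecOf a b d u 2 = d := by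
  simp [vecOf, Fin.ext_iff, two_mod_add_three]

theorem vecOf_of_ne {m : ℕ} (a b d : ℝ) (u : Fin (m + 3) → ℝ) {k : Fin (m + 3)}
    (h0 : k ≠ 0) (h1 : k ≠ 1) (h2 : k ≠ 2) : vecOf a b d u k = u k := by
  simp [vecOf, h0, h1, h2]

theorem vecOf_induction {m : ℕ} {P : Fin (m + 3) → Prop} (h0 : P 0) (h1 : P 1) (h2 : P 2)
    (h : ∀ k, k ≠ 0 → k ≠ 1 → k ≠ 2 → P k) (k : Fin (m + 3)) : P k := by
  by_cases e0 : k = 0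
  · exact e0 ▸ h0
  by_cases e1 : k = 1
  · exact e1 ▸ h1
  by_cases e2 : k = 2
  · exact e2 ▸ h2
  exact h k e0 e1 e2

/-- The geodesic through `p` with velocity `v`, where `E = c ^ 2 * (v 0 + p 2 * v 1) ≠ 0`. -/
def helix {m : ℕ} (c E : ℝ) (p v : Fin (m + 3) → ℝ) (t : ℝ) : Fin (m + 3) → ℝ :=
  vecOf
    (p 0 + E * t / c ^ 2 - (p 2 - v 1 / E) * ((v 1 * Real.sin (E * t)
        + v 2 * (1 - Real.cos (E * t))) / E)
      - (1 / E) * (v 1 ^ 2 * (t / 2 + Real.sin (E * t) * Real.cos (E * t) / (2 * E))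
        + v 2 ^ 2 * (t / 2 - Real.sin (E * t) * Real.cos (E * t) / (2 * E))
        + v 1 * v 2 * Real.sin (E * t) ^ 2 / E))
    (p 1 + (v 1 * Real.sin (E * t) + v 2 * (1 - Real.cos (E * t))) / E)
    (p 2 + (v 2 * Real.sin (E * t) - v 1 * (1 - Real.cos (E * t))) / E)
    (fun i => p i + v i * t)

def helixVelocity {m : ℕ} (c E : ℝ) (p v : Fin (m + 3) → ℝ) (t : ℝ) : Fin (m + 3) → ℝ :=
  vecOf
    (E / c ^ 2 - (p 2 + (v 2 * Real.sin (E * t) - v 1 * (1 - Real.cos (E * t))) / E) *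
      (v 1 * Real.cos (E * t) + v 2 * Real.sin (E * t)))
    (v 1 * Real.cos (E * t) + v 2 * Real.sin (E * t))
    (v 2 * Real.cos (E * t) - v 1 * Real.sin (E * t))
    v

theorem hasDerivAt_sin_mul (E t : ℝ) :
    HasDerivAt (fun s => Real.sin (E * s)) (E * Real.cos (E * t)) t := by
  have := ((hasDerivAt_id t).const_mul E).sin
  simpa [mul_comm] using this

theorem hasDerivAt_cos_mul (E t : ℝ) :
    HasDerivAt (fun s => Real.cos (E * s)) (-(E * Real.sin (E * t))) t := by
  have := ((hasDerivAt_id t).const_mul E).cos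
  simpa [mul_comm] using this

/-- Along the curve x_2 = (p_2 - v_1/E) + x_1'/E, so x_0' = E/c² - x_2 x_1' integrates to a linear
term, a multiple of x_1 - p_1, and the integral of x_1'², a combination of sin², cos² and sin·cos.
These are the three parts of the zeroth component. -/
theorem hasDerivAt_helix {m : ℕ} (c : ℝ) {E : ℝ} (hE : E ≠ 0) (p v : Fin (m + 3) → ℝ) (t : ℝ)
    (k : Fin (m + 3)) :
    HasDerivAt (fun s => helix c E p v s k) (helixVelocity c E p v t k) t := by
  have hs := hasDerivAt_sin_mul E t
  have hk := hasDerivAt_cos_mul E t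
  have hi := hasDerivAt_id' t
  have sq := Real.sin_sq_add_cos_sq (E * t)
  revert k
  refine vecOf_induction ?_ ?_ ?_ fun k h0 h1 h2 => ?_
  · simp only [helix, helixVelocity, vecOf_zero]
    have hsk := (hs.fun_mul hk).div_const (2 * E)
    have hz := ((hs.const_mul (v 1)).fun_add ((hk.const_sub 1).const_mul (v 2))).div_const E
    have := ((((hi.const_mul E).div_const (c ^ 2)).const_add (p 0)).fun_sub
      (hz.const_mul (p 2 - v 1 / E))).fun_sub
      ((((((hi.div_const 2).fun_add hsk).const_mul (v 1 ^ 2)).fun_add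
        (((hi.div_const 2).fun_sub hsk).const_mul (v 2 ^ 2))).fun_add
        (((hs.fun_pow 2).const_mul (v 1 * v 2)).div_const E)).const_mul (1 / E))
    refine this.congr_deriv ?_
    have hcc : Real.cos (E * t) ^ 2 = 1 - Real.sin (E * t) ^ 2 := by linarith
    field_simp
    push_cast
    ring_nf
    simp only [hcc]
    ring
  · simp only [helix, helixVelocity, vecOf_one]
    refine ((((hs.const_mul (v 1)).fun_add ((hk.const_sub 1).const_mul (v 2))).div_const
      E).const_add (p 1)).congr_deriv ?_
    field_simp
  · simp only [helix, helixVelocity, vecOf_two]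
    refine ((((hs.const_mul (v 2)).fun_sub ((hk.const_sub 1).const_mul (v 1))).div_const
      E).const_add (p 2)).congr_deriv ?_
    field_simp
  · simp only [helix, helixVelocity, vecOf_of_ne _ _ _ _ h0 h1 h2]
    exact ((hi.const_mul (v k)).const_add (p k)).congr_deriv (mul_one _)

/-- Conservation of E, which turns the geodesic equations for (x_1', x_2') into a linear rotation.
-/
theorem helixVelocity_twist {m : ℕ} {c : ℝ} (hc : 0 < c) (E : ℝ) (p v : Fin (m + 3) → ℝ) (t : ℝ) :
    c ^ 2 * (helixVelocity c E p v t 0 + helix c E p v t 2 * helixVelocity c E p v t 1) = E := by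
  simp only [helix, helixVelocity, vecOf_zero, vecOf_one, vecOf_two]
  field_simp
  ring

theorem hasDerivAt_helixVelocity {m : ℕ} {c : ℝ} (hc : 0 < c) {E : ℝ} (hE : E ≠ 0)
    (p v : Fin (m + 3) → ℝ) (t : ℝ) (k : Fin (m + 3)) :
    HasDerivAt (fun s => helixVelocity c E p v s k)
      (geodesicAcceleration c (helix c E p v t) (helixVelocity c E p v t) k) t := by
  have hs := hasDerivAt_sin_mul E t
  have hk := hasDerivAt_cos_mul E t
  have h1 := (hk.const_mul (v 1)).fun_add (hs.const_mul (v 2))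
  have h2 := hasDerivAt_helix c hE p v t 2
  simp only [helix, vecOf_two] at h2
  revert k
  refine vecOf_induction ?_ ?_ ?_ fun k h0 h1 h2 => ?_
  · rw [geodesicAcceleration_zero, helixVelocity_twist hc]
    simp only [helix, helixVelocity, vecOf_zero, vecOf_one, vecOf_two] at h2 ⊢
    refine ((h2.fun_mul h1).const_sub (E / c ^ 2)).congr_deriv ?_
    ring
  · rw [geodesicAcceleration_one, helixVelocity_twist hc]
    simp only [helixVelocity, vecOf_one, vecOf_two]
    refine h1.congr_deriv ?_
    ring
  · rw [geodesicAcceleration_two, helixVelocity_twist hc]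
    simp only [helixVelocity, vecOf_one, vecOf_two]
    refine ((hk.const_mul (v 2)).fun_sub (hs.const_mul (v 1))).congr_deriv ?_
    ring
  · simp only [helixVelocity, vecOf_of_ne _ _ _ _ h0 h1 h2,
      geodesicAcceleration_of_ne _ _ _ h0 h1 h2]
    exact hasDerivAt_const t (v k)

/-- Stated for v and the time varying together at fixed E, so that it also yields joint smoothness
of the family of closed geodesics, all of which have E = c. -/
theorem contDiff_helix {m : ℕ} (c E : ℝ) (p : Fin (m + 3) → ℝ) {F : Type*} [NormedAddCommGroup F]
    [NormedSpace ℝ F] {v : F → Fin (m + 3) → ℝ} {τ : F → ℝ} (hv : ∀ k, ContDiff ℝ ∞ fun q => v q k)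
    (hτ : ContDiff ℝ ∞ τ) : ContDiff ℝ ∞ fun q => helix c E p (v q) (τ q) := by
  rw [contDiff_pi]
  have hv1 := hv 1
  have hv2 := hv 2
  refine vecOf_induction ?_ ?_ ?_ fun k h0 h1 h2 => ?_
  · simp only [helix, vecOf_zero, div_eq_mul_inv]
    fun_prop
  · simp only [helix, vecOf_one, div_eq_mul_inv]
    fun_prop
  · simp only [helix, vecOf_two, div_eq_mul_inv]
    fun_prop
  · simp only [helix, vecOf_of_ne _ _ _ _ h0 h1 h2]
    have := hv k
    fun_prop

/-- No relation between E and v is needed: `v 0` does not enter `helix`, E takes its place. The two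
are matched only when the initial velocity is prescribed. -/
theorem isGeodesic_helix {m : ℕ} {c : ℝ} (hc : 0 < c) {E : ℝ} (hE : E ≠ 0)
    (p v : Fin (m + 3) → ℝ) : IsGeodesic (explicitMetric m c) (helix c E p v) :=
  isGeodesic_of_hasDerivAt hc (contDiff_helix c E p (v := fun _ => v) (fun _ => contDiff_const)
    contDiff_id) (hasDerivAt_helix c hE p v) (hasDerivAt_helixVelocity hc hE p v)

theorem helix_at_zero {m : ℕ} (c E : ℝ) (p v : Fin (m + 3) → ℝ) : helix c E p v 0 = p := by
  funext k
  revert k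
  refine vecOf_induction ?_ ?_ ?_ fun k h0 h1 h2 => ?_
  · simp [helix, vecOf_zero]
  · simp [helix, vecOf_one]
  · simp [helix, vecOf_two]
  · simp [helix, vecOf_of_ne _ _ _ _ h0 h1 h2]

theorem deriv_helix {m : ℕ} (c : ℝ) {E : ℝ} (hE : E ≠ 0) (p v : Fin (m + 3) → ℝ) :
    deriv (helix c E p v) = helixVelocity c E p v :=
  deriv_eq_of_hasDerivAt_apply (hasDerivAt_helix c hE p v)

theorem geodesicallyComplete_explicitMetric (m : ℕ) {c : ℝ} (hc : 0 < c) :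
    GeodesicallyComplete (explicitMetric m c) := by
  intro p v
  -- For E = 0 the velocities x_1' and x_2' are constant and x_0' = -x_2 x_1' is affine in t, so x_0
  -- is quadratic.
  by_cases hE : c ^ 2 * (v 0 + p 2 * v 1) = 0
  · have hv0 : v 0 = -p 2 * v 1 := by
      have := (mul_eq_zero.1 hE).resolve_left (by positivity)
      linarith
    let γ : ℝ → Fin (m + 3) → ℝ := fun t i =>
      p i + v i * t - δ i 0 * (v 1 * v 2 / 2) * t ^ 2
    let γ' : ℝ → Fin (m + 3) → ℝ := fun t i => v i - δ i 0 * (v 1 * v 2) * t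
    have h : ∀ t k, HasDerivAt (fun s => γ s k) (γ' t k) t := fun t k => by
      have hi := hasDerivAt_id' t
      refine (((hi.const_mul (v k)).const_add (p k)).fun_sub
        ((hi.fun_pow 2).const_mul (δ k 0 * (v 1 * v 2 / 2)))).congr_deriv ?_
      simp only [γ']
      push_cast
      ring
    have h' : ∀ t k, HasDerivAt (fun s => γ' s k) (geodesicAcceleration c (γ t) (γ' t) k) t :=
      fun t k => by
        refine (((hasDerivAt_id' t).const_mul (δ k 0 * (v 1 * v 2))).const_sub (v k)).congr_deriv ?_
        simp only [geodesicAcceleration, γ, γ', kroneckerDelta_self, delta_10, delta_20, hv0]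
        ring
    have hγ : ContDiff ℝ ∞ γ := by
      rw [contDiff_pi]
      intro i
      fun_prop
    refine ⟨γ, isGeodesic_of_hasDerivAt hc hγ h h', ?_, ?_⟩
    · funext i
      simp [γ]
    · rw [deriv_eq_of_hasDerivAt_apply h]
      funext i
      simp [γ']
  · refine ⟨helix c _ p v, isGeodesic_helix hc hE p v, helix_at_zero c _ p v, ?_⟩
    rw [deriv_helix c hE]
    funext k
    revert k
    refine vecOf_induction ?_ ?_ ?_ fun k h0 h1 h2 => ?_
    · simp only [helixVelocity, vecOf_zero, mul_zero, Real.sin_zero, Real.cos_zero]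
      field_simp
      ring
    · simp [helixVelocity, vecOf_one]
    · simp [helixVelocity, vecOf_two]
    · simp [helixVelocity, vecOf_of_ne _ _ _ _ h0 h1 h2]

/-! Closed geodesics. -/

/-- Uses only conserved quantities, not the explicit solution: E, ρ and K are constant, and a
combination of x_0, x_1 and the velocities grows linearly. Periodicity kills its slope. -/
theorem not_isClosedCausalGeodesic {m : ℕ} {c : ℝ} (hc : 0 < c) (γ : ℝ → Fin (m + 3) → ℝ) :
    ¬ IsClosedCausalGeodesic (explicitMetric m c) γ := by
  rintro ⟨⟨hg, ⟨T, hT, hper⟩, -⟩, hcausal⟩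
  have h := hg.hasDerivAt
  have h' := fun t => hg.hasDerivAt_deriv hc t
  have hconst : ∀ f : ℝ → ℝ, (∀ t, HasDerivAt f 0 t) → ∀ t, f t = f 0 := fun f hf t =>
    is_const_of_deriv_eq_zero (fun s => (hf s).differentiableAt) (fun s => (hf s).deriv) t 0
  obtain ⟨E, hE⟩ : ∃ E, ∀ t, c ^ 2 * (deriv γ t 0 + γ t 2 * deriv γ t 1) = E := by
    refine ⟨_, hconst _ fun t => ?_⟩
    refine (((h' t 0).fun_add ((h t 2).fun_mul (h' t 1))).const_mul (c ^ 2)).congr_deriv ?_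
    rw [geodesicAcceleration_zero, geodesicAcceleration_one]
    ring
  have a1 : ∀ t, HasDerivAt (fun s => deriv γ s 1) (E * deriv γ t 2) t := fun t => by
    rw [← hE t, ← geodesicAcceleration_one]
    exact h' t 1
  have a2 : ∀ t, HasDerivAt (fun s => deriv γ s 2) (-E * deriv γ t 1) t := fun t => by
    rw [← hE t, ← geodesicAcceleration_two]
    exact h' t 2
  obtain ⟨ρ, hρ⟩ : ∃ ρ, ∀ t, deriv γ t 1 ^ 2 + deriv γ t 2 ^ 2 = ρ := by
    refine ⟨_, hconst _ fun t => ?_⟩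
    refine (((a1 t).fun_pow 2).fun_add ((a2 t).fun_pow 2)).congr_deriv ?_
    push_cast
    ring
  obtain ⟨K, hK⟩ : ∃ K, ∀ t, E * γ t 2 - deriv γ t 1 = K := by
    refine ⟨_, hconst _ fun t => ?_⟩
    refine (((h t 2).const_mul E).fun_sub (a1 t)).congr_deriv ?_
    ring
  -- In G' the term 2E²x_0' produces -2E²x_2x_1'. Since Ex_2 = K + x_1', the x_1 term of `G` removes
  -- its K part, and the product x_1'x_2' turns the remaining -2Ex_1'² into -Eρ.
  let κ : ℝ := 2 * E ^ 3 / c ^ 2 - E * ρ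
  let G : ℝ → ℝ := fun t => 2 * E ^ 2 * γ t 0 + 2 * E * K * γ t 1 - deriv γ t 1 * deriv γ t 2
  have hG : ∀ t, HasDerivAt (fun s => G s - κ * s) 0 t := fun t => by
    refine (((((h t 0).const_mul (2 * E ^ 2)).fun_add ((h t 1).const_mul (2 * E * K))).fun_sub
      ((a1 t).fun_mul (a2 t))).fun_sub ((hasDerivAt_id' t).const_mul κ)).congr_deriv ?_
    have e0 : deriv γ t 0 = E / c ^ 2 - γ t 2 * deriv γ t 1 := by
      rw [← hE t]
      field_simp
      ring
    simp only [κ]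
    rw [e0, ← hK t, ← hρ t]
    ring
  have hdper : deriv γ T = deriv γ 0 := by
    have := deriv_comp_add_const γ T 0
    rw [show (fun x => γ (x + T)) = γ from funext hper, zero_add] at this
    exact this.symm
  have hGT : G T = G 0 := by
    have := hper 0
    rw [zero_add] at this
    simp only [G, hdper, this]
  have hκ : κ = 0 := by
    have := hconst _ hG T
    simp only [hGT, mul_zero, sub_zero] at this
    have h2 : κ * T = 0 := by linarith
    exact (mul_eq_zero.1 h2).resolve_right hT.ne'
  have hform : metricForm (explicitMetric m c) (γ 0) (deriv γ 0) (deriv γ 0) =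
      -(E ^ 2 / c ^ 2) + ρ + ∑ i : Fin m, deriv γ 0 i.succ.succ.succ * deriv γ 0 i.succ.succ.succ := by
    rw [metricForm_explicitMetric', ← hE 0, ← hρ 0]
    field_simp
    ring
  have hR : 0 ≤ ∑ i : Fin m, deriv γ 0 i.succ.succ.succ * deriv γ 0 i.succ.succ.succ :=
    Finset.sum_nonneg fun i _ => mul_self_nonneg _
  have hρ0 : 0 ≤ ρ := by
    rw [← hρ 0]
    positivity
  have hle : metricForm (explicitMetric m c) (γ 0) (deriv γ 0) (deriv γ 0) ≤ 0 :=
    (hcausal 0).elim le_of_lt fun h => h.2.le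
  by_cases hE0 : E = 0
  · have hform2 := metricForm_explicitMetric c (γ 0) (deriv γ 0) (deriv γ 0)
    have ht : deriv γ 0 0 + γ 0 2 * deriv γ 0 1 = 0 := by
      have := hE 0
      rw [hE0] at this
      exact (mul_eq_zero.1 this).resolve_left (by positivity)
    rw [ht, mul_zero, zero_add] at hform2
    have hnn : 0 ≤ ∑ i : Fin (m + 2), deriv γ 0 i.succ * deriv γ 0 i.succ :=
      Finset.sum_nonneg fun i _ => mul_self_nonneg _
    rcases hcausal 0 with hlt | ⟨hne, -⟩
    · unfold IsTimelike at hlt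
      linarith
    · apply hne
      have hz := (Finset.sum_eq_zero_iff_of_nonneg
        (fun (i : Fin (m + 2)) _ => mul_self_nonneg (deriv γ 0 i.succ))).1 (by linarith)
      have hz' : ∀ i : Fin (m + 2), deriv γ 0 i.succ = 0 := fun i =>
        mul_self_eq_zero.1 (hz i (Finset.mem_univ i))
      have h1 : deriv γ 0 1 = 0 := hz' 0
      funext i
      refine Fin.cases ?_ (fun k => ?_) i
      · simpa [h1] using ht
      · exact hz' k
  · have h2 : ρ = 2 * (E ^ 2 / c ^ 2) := by
      have : E * (2 * (E ^ 2 / c ^ 2) - ρ) = 0 := by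
        rw [← hκ]
        simp only [κ]
        ring
      have := (mul_eq_zero.1 this).resolve_left hE0
      linarith
    have : 0 < E ^ 2 / c ^ 2 := by positivity
    linarith

/-- The initial velocities of the closed geodesics through `p`, parametrized stereographically. -/
def circleVelocity {m : ℕ} (c : ℝ) (p : Fin (m + 3) → ℝ) (s : ℝ) : Fin (m + 3) → ℝ :=
  vecOf (1 / c - p 2 * (√2 * (1 - s ^ 2) / (1 + s ^ 2))) (√2 * (1 - s ^ 2) / (1 + s ^ 2))
    (√2 * (2 * s) / (1 + s ^ 2)) 0

/-- This is the closing condition ρ = 2E²/c² for E = c. The zeroth component of the velocity is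
chosen so that indeed c²(v_0 + p_2 v_1) = c. -/
theorem circleVelocity_sq {m : ℕ} (c : ℝ) (p : Fin (m + 3) → ℝ) (s : ℝ) :
    circleVelocity c p s 1 ^ 2 + circleVelocity c p s 2 ^ 2 = 2 := by
  simp only [circleVelocity, vecOf_one, vecOf_two]
  have : (1 + s ^ 2) ≠ 0 := by positivity
  field_simp
  rw [Real.sq_sqrt two_pos.le]
  ring

theorem circleVelocity_injective {m : ℕ} (c : ℝ) (p : Fin (m + 3) → ℝ) {s s' : ℝ}
    (h1 : circleVelocity c p s 1 = circleVelocity c p s' 1)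
    (h2 : circleVelocity c p s 2 = circleVelocity c p s' 2) : s = s' := by
  simp only [circleVelocity, vecOf_one, vecOf_two] at h1 h2
  have e : (1 + s ^ 2) ≠ 0 := by positivity
  have e' : (1 + s' ^ 2) ≠ 0 := by positivity
  have e2 : √2 ≠ 0 := by positivity
  have h3 : (1 + s' ^ 2) = (1 + s ^ 2) := by
    field_simp at h1
    linarith
  rw [h3] at h2
  field_simp at h2
  linarith

theorem contDiff_circleVelocity {m : ℕ} (c : ℝ) (p : Fin (m + 3) → ℝ) (k : Fin (m + 3)) :
    ContDiff ℝ ∞ fun s => circleVelocity c p s k := by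
  have hd : ContDiff ℝ ∞ fun s : ℝ => (1 + s ^ 2) := by fun_prop
  have h0 : ∀ s : ℝ, 1 + s ^ 2 ≠ 0 := fun s => by positivity
  have h1 : ContDiff ℝ ∞ fun s : ℝ => √2 * (1 - s ^ 2) / (1 + s ^ 2) :=
    ContDiff.div (by fun_prop) hd h0
  have h2 : ContDiff ℝ ∞ fun s : ℝ => √2 * (2 * s) / (1 + s ^ 2) :=
    ContDiff.div (by fun_prop) hd h0
  revert k
  refine vecOf_induction ?_ ?_ ?_ fun k h0 h1 h2 => ?_
  · simp only [circleVelocity, vecOf_zero]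
    exact contDiff_const.sub (contDiff_const.mul h1)
  · simpa only [circleVelocity, vecOf_one] using h1
  · simpa only [circleVelocity, vecOf_two] using h2
  · simp only [circleVelocity, vecOf_of_ne _ _ _ _ h0 h1 h2]
    exact contDiff_const

/-- The projection to the (x_1, x_2)-plane is confined to the circle of radius √2/c about (p_1 +
v_2/c, p_2 - v_1/c). The centre determines the initial direction, which later separates the images.
-/
theorem circle_mem {m : ℕ} {c : ℝ} (hc : 0 < c) (p : Fin (m + 3) → ℝ) (s t : ℝ) :
    (c * (helix c c p (circleVelocity c p s) t 1 - p 1) - circleVelocity c p s 2) ^ 2 +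
      (c * (helix c c p (circleVelocity c p s) t 2 - p 2) + circleVelocity c p s 1) ^ 2 = 2 := by
  have h := circleVelocity_sq c p s
  have sq := Real.sin_sq_add_cos_sq (c * t)
  simp only [helix, vecOf_one, vecOf_two]
  have e1 : c * (p 1 + (circleVelocity c p s 1 * Real.sin (c * t) +
      circleVelocity c p s 2 * (1 - Real.cos (c * t))) / c - p 1) - circleVelocity c p s 2 =
      circleVelocity c p s 1 * Real.sin (c * t) - circleVelocity c p s 2 * Real.cos (c * t) := by
    field_simp
    ring
  have e2 : c * (p 2 + (circleVelocity c p s 2 * Real.sin (c * t) -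
      circleVelocity c p s 1 * (1 - Real.cos (c * t))) / c - p 2) + circleVelocity c p s 1 =
      circleVelocity c p s 2 * Real.sin (c * t) + circleVelocity c p s 1 * Real.cos (c * t) := by
    field_simp
    ring
  rw [e1, e2]
  linear_combination (circleVelocity c p s 1 ^ 2 + circleVelocity c p s 2 ^ 2) * sq + h

theorem isClosedSpacelikeGeodesic_circle {m : ℕ} {c : ℝ} (hc : 0 < c) (p : Fin (m + 3) → ℝ)
    (s : ℝ) :
    IsClosedSpacelikeGeodesic (explicitMetric m c) (helix c c p (circleVelocity c p s)) := by
  have hv := circleVelocity_sq c p s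
  have hsp : ∀ t, IsSpacelike (explicitMetric m c) (helix c c p (circleVelocity c p s) t)
      (deriv (helix c c p (circleVelocity c p s)) t) := fun t => by
    rw [deriv_helix c hc.ne', IsSpacelike, metricForm_explicitMetric']
    have hθ := helixVelocity_twist hc c p (circleVelocity c p s) t
    set θ := helixVelocity c c p (circleVelocity c p s) t 0 +
      helix c c p (circleVelocity c p s) t 2 * helixVelocity c c p (circleVelocity c p s) t 1
    have hR : 0 ≤ ∑ i : Fin m, helixVelocity c c p (circleVelocity c p s) t i.succ.succ.succ *
        helixVelocity c c p (circleVelocity c p s) t i.succ.succ.succ :=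
      Finset.sum_nonneg fun i _ => mul_self_nonneg _
    have h2 : -c ^ 2 * θ * θ = -1 := by
      have hθ' : c * θ = 1 := by
        have : c * (c * θ - 1) = 0 := by linarith
        have := (mul_eq_zero.1 this).resolve_left hc.ne'
        linarith
      linear_combination (-c * θ - 1) * hθ'
    have h3 : helixVelocity c c p (circleVelocity c p s) t 1 *
        helixVelocity c c p (circleVelocity c p s) t 1 +
        helixVelocity c c p (circleVelocity c p s) t 2 *
        helixVelocity c c p (circleVelocity c p s) t 2 = 2 := by
      simp only [helixVelocity, vecOf_one, vecOf_two]
      linear_combination hv + (circleVelocity c p s 1 ^ 2 + circleVelocity c p s 2 ^ 2) *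
        Real.sin_sq_add_cos_sq (c * t)
    linarith
  refine ⟨⟨isGeodesic_helix hc hc.ne' p _, ⟨2 * Real.pi / c, by positivity, fun t => ?_⟩,
    ⟨0, fun h => ?_⟩⟩, hsp⟩
  · have ht : c * (t + 2 * Real.pi / c) = c * t + 2 * Real.pi := by field_simp
    funext k
    revert k
    refine vecOf_induction ?_ ?_ ?_ fun k h0 h1 h2 => ?_
    · simp only [helix, vecOf_zero, ht, Real.sin_add_two_pi, Real.cos_add_two_pi]
      -- Over one period x_0 changes by (2π/c²)(1 - ρ/2), which vanishes because ρ = 2.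
      linear_combination (-Real.pi / c ^ 2) * hv
    · simp only [helix, vecOf_one, ht, Real.sin_add_two_pi, Real.cos_add_two_pi]
    · simp only [helix, vecOf_two, ht, Real.sin_add_two_pi, Real.cos_add_two_pi]
    · simp [helix, circleVelocity, vecOf_of_ne _ _ _ _ h0 h1 h2]
  · have := hsp 0
    rw [h, IsSpacelike] at this
    simp [metricForm] at this

theorem exists_closed_spacelike_family {m : ℕ} {c : ℝ} (hc : 0 < c) (p : Fin (m + 3) → ℝ) :
    ∃ Γ : ℝ → ℝ → Fin (m + 3) → ℝ,
      ContDiff ℝ ∞ (Function.uncurry Γ) ∧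
      (∀ s, IsClosedSpacelikeGeodesic (explicitMetric m c) (Γ s) ∧ Γ s 0 = p) ∧
      Function.Injective fun s => Set.range (Γ s) := by
  refine ⟨fun s => helix c c p (circleVelocity c p s), ?_, fun s =>
    ⟨isClosedSpacelikeGeodesic_circle hc p s, helix_at_zero c c p _⟩, fun s s' h => ?_⟩
  · exact contDiff_helix c c p (F := ℝ × ℝ) (v := fun q => circleVelocity c p q.1)
      (τ := fun q => q.2) (fun k => (contDiff_circleVelocity c p k).comp contDiff_fst) contDiff_snd
  · have hmem : helix c c p (circleVelocity c p s) (Real.pi / c) ∈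
        Set.range (helix c c p (circleVelocity c p s')) :=
      (Set.ext_iff.1 h _).1 (Set.mem_range_self _)
    obtain ⟨t, ht⟩ := hmem
    have h1 := circle_mem hc p s' t
    rw [ht] at h1
    have hπ : c * (Real.pi / c) = Real.pi := by field_simp
    simp only [helix, vecOf_one, vecOf_two, hπ, Real.sin_pi, Real.cos_pi] at h1
    have e1 : c * (p 1 + (circleVelocity c p s 1 * 0 +
      circleVelocity c p s 2 * (1 - -1)) / c - p 1) = 2 * circleVelocity c p s 2 := by
      field_simp
      ring
    have e2 : c * (p 2 + (circleVelocity c p s 2 * 0 -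
      circleVelocity c p s 1 * (1 - -1)) / c - p 2) = -2 * circleVelocity c p s 1 := by
      field_simp
      ring
    rw [e1, e2] at h1
    have hv := circleVelocity_sq c p s
    have hv' := circleVelocity_sq c p s'
    have h2 : (circleVelocity c p s 1 - circleVelocity c p s' 1) ^ 2 +
        (circleVelocity c p s 2 - circleVelocity c p s' 2) ^ 2 = 0 := by
      linear_combination (1 / 2) * h1 - hv + (1 / 2) * hv'
    have h3 := sq_nonneg (circleVelocity c p s 1 - circleVelocity c p s' 1)
    have h4 := sq_nonneg (circleVelocity c p s 2 - circleVelocity c p s' 2)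
    exact circleVelocity_injective c p
      (sub_eq_zero.1 (pow_eq_zero_iff two_ne_zero |>.1 (by linarith)))
      (sub_eq_zero.1 (pow_eq_zero_iff two_ne_zero |>.1 (by linarith)))

/-! Extension of timelike paths to closed timelike paths. -/

/-- A `C^r` map whose values near `α` and near `α + T` match can be made periodic. -/
theorem exists_periodic_of_overlap {E : Type*} [NormedAddCommGroup E] [NormedSpace ℝ E]
    {r : ℕ∞ω} {U : ℝ → E} {α T ε : ℝ} (hT : 0 < T) (hε : 0 < ε) (hU : ContDiff ℝ r U)
    (h : ∀ t, |t - α| < ε → U (t + T) = U t) :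
    ∃ γ : ℝ → E, ContDiff ℝ r γ ∧ Function.Periodic γ T ∧
      (∀ t ∈ Set.Ico α (α + T), γ t = U t) ∧
      ∀ t, ∃ s ∈ Set.Ico α (α + T), γ t = U s ∧ deriv γ t = deriv U s := by
  -- Near every point the periodization is a single translate of U. Only at the left end of a
  -- fundamental interval does the reduction jump, and there the overlap hypothesis absorbs the
  -- jump.
  have hγ : ∀ t₀, (fun t => U (toIcoMod hT α t)) =ᶠ[nhds t₀]
      fun t => U (t - toIcoDiv hT α t₀ • T) := by
    intro t₀
    have hs := toIcoMod_mem_Ico hT α t₀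
    rw [← self_sub_toIcoDiv_zsmul] at hs
    set n := toIcoDiv hT α t₀
    have hδ : 0 < min ε T := lt_min hε hT
    have hc : ContinuousAt (fun t : ℝ => t - n • T) t₀ := by fun_prop
    have hmem : Set.Ioo (α - min ε T) (α + T) ∈ nhds (t₀ - n • T) :=
      Ioo_mem_nhds (by linarith [hs.1]) hs.2
    filter_upwards [hc hmem] with t ht
    simp only [Set.mem_preimage, Set.mem_Ioo] at ht
    by_cases hα : α ≤ t - n • T
    · rw [(toIcoMod_eq_iff hT).2 ⟨⟨hα, ht.2⟩, n, by abel⟩]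
    · push Not at hα
      have h1 : toIcoMod hT α t = t - n • T + T := by
        refine (toIcoMod_eq_iff hT).2 ⟨⟨?_, by linarith⟩, n - 1, ?_⟩
        · linarith [min_le_right ε T, ht.1]
        · rw [sub_smul, one_smul]
          abel
      rw [h1, h]
      rw [abs_lt]
      constructor <;> linarith [min_le_left ε T, ht.1]
  refine ⟨fun t => U (toIcoMod hT α t), ?_, fun t => ?_, fun t ht => ?_, fun t => ?_⟩
  · rw [contDiff_iff_contDiffAt]
    intro t₀
    refine ContDiffAt.congr_of_eventuallyEq ?_ (hγ t₀)
    exact (hU.comp (contDiff_id.sub contDiff_const)).contDiffAt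
  · simp only [toIcoMod_add_right]
  · simp only [(toIcoMod_eq_self hT).2 ht]
  · refine ⟨toIcoMod hT α t, toIcoMod_mem_Ico hT α t, rfl, ?_⟩
    rw [(hγ t).deriv_eq, deriv_comp_sub_const, self_sub_toIcoDiv_zsmul]

/-! ### Smooth cutoff functions. -/

theorem deriv_eq_zero_of_eqOn {f : ℝ → ℝ} {s : Set ℝ} {d t : ℝ} (hs : IsOpen s)
    (h : ∀ u ∈ s, f u = d) (ht : t ∈ s) : deriv f t = 0 := by
  have : f =ᶠ[nhds t] fun _ => d := Filter.eventually_of_mem (hs.mem_nhds ht) h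
  rw [this.deriv_eq, deriv_const]

/-- A smooth function that is `0` off `(u, v)` and `1` on `[u + 1, v - 1]`. -/
def smoothPlateau (u v t : ℝ) : ℝ := Real.smoothTransition (t - u) * Real.smoothTransition (v - t)

theorem contDiff_smoothPlateau (u v : ℝ) {n : ℕ∞} : ContDiff ℝ n (smoothPlateau u v) :=
  (Real.smoothTransition.contDiff.comp (contDiff_id.sub contDiff_const)).mul
    (Real.smoothTransition.contDiff.comp (contDiff_const.sub contDiff_id))

theorem smoothPlateau_of_le {u v t : ℝ} (h : t ≤ u) : smoothPlateau u v t = 0 := by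
  rw [smoothPlateau, Real.smoothTransition.zero_of_nonpos (by linarith), zero_mul]

theorem smoothPlateau_of_ge {u v t : ℝ} (h : v ≤ t) : smoothPlateau u v t = 0 := by
  rw [smoothPlateau, Real.smoothTransition.zero_of_nonpos (x := v - t) (by linarith), mul_zero]

theorem smoothPlateau_of_mem {u v t : ℝ} (h : u + 1 ≤ t) (h' : t ≤ v - 1) :
    smoothPlateau u v t = 1 := by
  rw [smoothPlateau, Real.smoothTransition.one_of_one_le (by linarith),
    Real.smoothTransition.one_of_one_le (by linarith), one_mul]

/-- A smooth monotone function that is `0` on `(-∞, 0]` and the identity on `[ε, ∞)`. -/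
def smoothRamp (ε t : ℝ) : ℝ := t * Real.smoothTransition (t / ε)

theorem contDiff_smoothRamp (ε : ℝ) {n : ℕ∞} : ContDiff ℝ n (smoothRamp ε) :=
  contDiff_id.mul (Real.smoothTransition.contDiff.comp (contDiff_id.div_const ε))

theorem smoothRamp_of_nonpos {ε t : ℝ} (hε : 0 < ε) (h : t ≤ 0) : smoothRamp ε t = 0 := by
  rw [smoothRamp, Real.smoothTransition.zero_of_nonpos (div_nonpos_of_nonpos_of_nonneg h hε.le),
    mul_zero]

theorem smoothRamp_of_ge {ε t : ℝ} (hε : 0 < ε) (h : ε ≤ t) : smoothRamp ε t = t := by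
  rw [smoothRamp, Real.smoothTransition.one_of_one_le ((one_le_div hε).2 h), mul_one]

theorem smoothRamp_nonneg {ε : ℝ} (hε : 0 < ε) (t : ℝ) : 0 ≤ smoothRamp ε t := by
  rcases le_total t 0 with h | h
  · rw [smoothRamp_of_nonpos hε h]
  · exact mul_nonneg h (Real.smoothTransition.nonneg _)

theorem monotone_smoothRamp {ε : ℝ} (hε : 0 < ε) : Monotone (smoothRamp ε) := by
  intro u v huv
  rcases le_total u 0 with h | h
  · rw [smoothRamp_of_nonpos hε h]
    exact smoothRamp_nonneg hε v
  · exact mul_le_mul huv (Real.smoothTransition.monotone (by gcongr))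
      (Real.smoothTransition.nonneg _) (h.trans huv)

/-- A smooth monotone function that vanishes on `[a, b]` and has slope `1` off `[a - ε, b + ε]`. -/
def smoothDeadZone (ε a b t : ℝ) : ℝ := smoothRamp ε (t - b) - smoothRamp ε (a - t)

theorem contDiff_smoothDeadZone (ε a b : ℝ) {n : ℕ∞} : ContDiff ℝ n (smoothDeadZone ε a b) :=
  ((contDiff_smoothRamp ε).comp (contDiff_id.sub contDiff_const)).sub
    ((contDiff_smoothRamp ε).comp (contDiff_const.sub contDiff_id))

theorem smoothDeadZone_of_mem {ε a b t : ℝ} (hε : 0 < ε) (ha : a ≤ t) (hb : t ≤ b) :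
    smoothDeadZone ε a b t = 0 := by
  rw [smoothDeadZone, smoothRamp_of_nonpos hε (by linarith), smoothRamp_of_nonpos hε (by linarith),
    sub_zero]

theorem smoothDeadZone_of_le {ε a b t : ℝ} (hε : 0 < ε) (hab : a ≤ b) (h : t ≤ a - ε) :
    smoothDeadZone ε a b t = t - a := by
  rw [smoothDeadZone, smoothRamp_of_nonpos hε (by linarith), smoothRamp_of_ge hε (by linarith)]
  ring

theorem smoothDeadZone_of_ge {ε a b t : ℝ} (hε : 0 < ε) (hab : a ≤ b) (h : b + ε ≤ t) :
    smoothDeadZone ε a b t = t - b := by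
  rw [smoothDeadZone, smoothRamp_of_ge hε (by linarith), smoothRamp_of_nonpos hε (by linarith),
    sub_zero]

theorem deriv_smoothDeadZone_nonneg {ε : ℝ} (hε : 0 < ε) (a b t : ℝ) :
    0 ≤ deriv (smoothDeadZone ε a b) t := by
  refine Monotone.deriv_nonneg fun u v huv => ?_
  exact sub_le_sub (monotone_smoothRamp hε (by linarith)) (monotone_smoothRamp hε (by linarith))

theorem deriv_smoothDeadZone_of_notMem {ε a b t : ℝ} (hε : 0 < ε) (hab : a ≤ b)
    (h : t ∉ Set.Icc (a - ε) (b + ε)) : deriv (smoothDeadZone ε a b) t = 1 := by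
  rw [Set.mem_Icc, not_and_or, not_le, not_le] at h
  rcases h with h | h
  · have : smoothDeadZone ε a b =ᶠ[nhds t] fun u => u - a := by
      filter_upwards [Iio_mem_nhds h] with u hu
      exact smoothDeadZone_of_le hε hab (le_of_lt hu)
    rw [this.deriv_eq]
    simp
  · have : smoothDeadZone ε a b =ᶠ[nhds t] fun u => u - b := by
      filter_upwards [Ioi_mem_nhds h] with u hu
      exact smoothDeadZone_of_ge hε hab (le_of_lt hu)
    rw [this.deriv_eq]
    simp

/-- In the coordinates `y = x_0 + x_1 x_2 / 2`, `x_1`, `x_2` a curve on which this is positive is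
timelike for `g^c_3`. -/
def timelikeMargin (c : ℝ) (y z₁ z₂ : ℝ → ℝ) (t : ℝ) : ℝ :=
  c * (deriv y t + (z₂ t * deriv z₁ t - z₁ t * deriv z₂ t) / 2)
    - √(deriv z₁ t ^ 2 + deriv z₂ t ^ 2)

/-! ### Closing up timelike curves in dimension three. -/

theorem continuous_timelikeMargin (c : ℝ) {r : ℕ∞ω} (hr : 1 ≤ r) {y z₁ z₂ : ℝ → ℝ}
    (hy : ContDiff ℝ r y) (h₁ : ContDiff ℝ r z₁) (h₂ : ContDiff ℝ r z₂) :
    Continuous (timelikeMargin c y z₁ z₂) := by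
  have a := hy.continuous_deriv hr
  have a₁ := h₁.continuous_deriv hr
  have a₂ := h₂.continuous_deriv hr
  have b₁ := h₁.continuous
  have b₂ := h₂.continuous
  unfold timelikeMargin
  fun_prop

theorem timelikeMargin_congr (c : ℝ) {y z₁ z₂ y' z₁' z₂' : ℝ → ℝ} {t : ℝ}
    (hy : y =ᶠ[nhds t] y') (h₁ : z₁ =ᶠ[nhds t] z₁') (h₂ : z₂ =ᶠ[nhds t] z₂') :
    timelikeMargin c y z₁ z₂ t = timelikeMargin c y' z₁' z₂' t := by
  rw [timelikeMargin, timelikeMargin, hy.deriv_eq, h₁.deriv_eq, h₂.deriv_eq, h₁.eq_of_nhds,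
    h₂.eq_of_nhds]

theorem exists_margin_neighborhood {F : ℝ → ℝ} (hF : Continuous F) {a b : ℝ} (hab : a ≤ b)
    (h : ∀ t ∈ Set.Icc a b, 0 < F t) :
    ∃ ε, 0 < ε ∧ ε < 1 ∧ ∀ t ∈ Set.Icc (a - ε) (b + ε), 0 < F t := by
  have ho : IsOpen {t | 0 < F t} := isOpen_lt continuous_const hF
  obtain ⟨ε₁, h₁, H₁⟩ := Metric.isOpen_iff.1 ho a (h a ⟨le_rfl, hab⟩)
  obtain ⟨ε₂, h₂, H₂⟩ := Metric.isOpen_iff.1 ho b (h b ⟨hab, le_rfl⟩)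
  set ε := min (min ε₁ ε₂) 1
  have e₁ : ε ≤ ε₁ := (min_le_left _ _).trans (min_le_left _ _)
  have e₂ : ε ≤ ε₂ := (min_le_left _ _).trans (min_le_right _ _)
  have e₃ : ε ≤ 1 := min_le_right _ _
  have hε : 0 < ε := lt_min (lt_min h₁ h₂) one_pos
  refine ⟨ε / 2, by linarith, by linarith, fun t ht => ?_⟩
  by_cases hta : t < a
  · refine H₁ ?_
    rw [Metric.mem_ball, Real.dist_eq, abs_lt]
    constructor <;> linarith [ht.1]
  by_cases htb : b < t
  · refine H₂ ?_
    rw [Metric.mem_ball, Real.dist_eq, abs_lt]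
    constructor <;> linarith [ht.2]
  exact h t ⟨not_lt.1 hta, not_lt.1 htb⟩

/-- Adding M·H to y makes the margin positive away from [a, b] but raises y by 10M over a period.
The term -10M·S undoes this on [b + 4, b + 5], while a spiral of radius Lψ supplies the compensating
area term L²/2. The spiral begins and ends at the origin because ψ vanishes there, so it need not
make whole turns. -/
theorem exists_closing_of_compact {c : ℝ} (hc : 0 < c) {r : ℕ∞} (hr : 1 ≤ (r : ℕ∞ω)) {a b ε : ℝ}
    (hab : a ≤ b) (hε : 0 < ε) (hε1 : ε < 1) {y z₁ z₂ : ℝ → ℝ} (hy : ContDiff ℝ r y)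
    (h₁ : ContDiff ℝ r z₁) (h₂ : ContDiff ℝ r z₂)
    (hy0 : ∀ t, t ∉ Set.Ioo (a - 2) (b + 2) → y t = 0)
    (hz₁ : ∀ t, t ∉ Set.Ioo (a - 2) (b + 2) → z₁ t = 0)
    (hz₂ : ∀ t, t ∉ Set.Ioo (a - 2) (b + 2) → z₂ t = 0)
    (hpos : ∀ t ∈ Set.Icc (a - ε) (b + ε), 0 < timelikeMargin c y z₁ z₂ t) :
    ∃ Y Z₁ Z₂ : ℝ → ℝ, ContDiff ℝ r Y ∧ ContDiff ℝ r Z₁ ∧ ContDiff ℝ r Z₂ ∧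
      (∀ t ∈ Set.Icc a b, Y t = y t ∧ Z₁ t = z₁ t ∧ Z₂ t = z₂ t) ∧
      (∀ t, |t - (a - 3)| < 1 → Y (t + (b - a + 10)) = Y t ∧ Z₁ (t + (b - a + 10)) = Z₁ t ∧
        Z₂ (t + (b - a + 10)) = Z₂ t) ∧
      ∀ t ∈ Set.Icc (a - 3) (b + 7), 0 < timelikeMargin c Y Z₁ Z₂ t := by
  let ψ := smoothPlateau (b + 3) (b + 6)
  let S : ℝ → ℝ := fun t => Real.smoothTransition (t - (b + 4))
  let H := smoothDeadZone ε a b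
  have hψ : ∀ {n : ℕ∞}, ContDiff ℝ n ψ := contDiff_smoothPlateau _ _
  have hS : ∀ {n : ℕ∞}, ContDiff ℝ n S :=
    Real.smoothTransition.contDiff.comp (contDiff_id.sub contDiff_const)
  have hH : ∀ {n : ℕ∞}, ContDiff ℝ n H := contDiff_smoothDeadZone _ _ _
  have hr0 : (r : ℕ∞ω) ≠ 0 := (zero_lt_one.trans_le hr).ne'
  have hψc : Continuous (deriv ψ) := (hψ (n := 1)).continuous_deriv le_rfl
  have hSc : Continuous (deriv S) := (hS (n := 1)).continuous_deriv le_rfl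
  obtain ⟨B, hB⟩ := (isCompact_Icc (a := a - 3) (b := b + 7)).exists_bound_of_continuousOn
    (continuous_timelikeMargin c hr hy h₁ h₂).continuousOn
  obtain ⟨C₁, hC₁⟩ := (isCompact_Icc (a := a - 3) (b := b + 7)).exists_bound_of_continuousOn
    (f := fun t => √(deriv ψ t ^ 2 + ψ t ^ 2))
    (((hψc.pow 2).add ((hψ (n := 1)).continuous.pow 2)).sqrt.continuousOn)
  obtain ⟨C₂, hC₂⟩ := (isCompact_Icc (a := a - 3) (b := b + 7)).exists_bound_of_continuousOn
    hSc.continuousOn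
  have hmem : a ∈ Set.Icc (a - 3) (b + 7) := ⟨by linarith, by linarith⟩
  have hB0 : 0 ≤ B := (norm_nonneg _).trans (hB a hmem)
  have hC₁0 : 0 ≤ C₁ := (norm_nonneg _).trans (hC₁ a hmem)
  have hC₂0 : 0 ≤ C₂ := (norm_nonneg _).trans (hC₂ a hmem)
  -- Slope M₀ alone beats the worst margin -B of the given curve.
  let M₀ := (B + 1) / c
  have hM₀ : 0 < M₀ := by positivity
  -- The slope M must also outweigh the speed of the spiral, at most L·C₁, so it grows linearly in
  -- L. The decrease of y has rate at most 10·M·C₂, also linear in L, against the quadratic gain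
  -- L²/2; this L suffices.
  let L := 1 + 20 * C₂ * (C₁ / c + M₀)
  have hL : 1 ≤ L := by
    have : 0 ≤ 20 * C₂ * (C₁ / c + M₀) := by positivity
    simp only [L]
    linarith
  let M := L * C₁ / c + M₀
  have hLC : 0 ≤ L * C₁ / c := by positivity
  have hM : M₀ ≤ M := by
    simp only [M]
    linarith
  have hcM₀ : c * M₀ = B + 1 := by
    simp only [M₀]
    field_simp
  have hcM : c * M = L * C₁ + (B + 1) := by
    simp only [M]
    rw [mul_add, hcM₀]
    field_simp
  have hML : 10 * M * C₂ ≤ L ^ 2 / 2 := by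
    have e1 : M ≤ L * (C₁ / c + M₀) := by
      simp only [M]
      have := mul_le_mul_of_nonneg_right hL hM₀.le
      rw [mul_add, mul_div_assoc]
      linarith
    have e2 : 10 * M * C₂ ≤ 10 * (L * (C₁ / c + M₀)) * C₂ := by gcongr
    have e3 : 20 * C₂ * (C₁ / c + M₀) ≤ L := by simp only [L]; linarith
    have e4 := mul_le_mul_of_nonneg_left e3 (by linarith : (0 : ℝ) ≤ L)
    nlinarith
  clear_value M L M₀
  let Y : ℝ → ℝ := fun t => y t + M * (H t - 10 * S t)
  let Z₁ : ℝ → ℝ := fun t => z₁ t + L * (ψ t * Real.cos t)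
  let Z₂ : ℝ → ℝ := fun t => z₂ t - L * (ψ t * Real.sin t)
  have dY : ∀ t, deriv Y t = deriv y t + M * (deriv H t - 10 * deriv S t) := fun t =>
    ((hy.differentiable hr0 t).hasDerivAt.fun_add
      (((hH (n := 1)).differentiable one_ne_zero t).hasDerivAt.fun_sub
        (((hS (n := 1)).differentiable one_ne_zero t).hasDerivAt.const_mul 10)
          |>.const_mul M)).deriv
  have dZ₁ : ∀ t, deriv Z₁ t =
      deriv z₁ t + L * (deriv ψ t * Real.cos t + ψ t * -Real.sin t) := fun t =>
    ((h₁.differentiable hr0 t).hasDerivAt.fun_add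
      ((((hψ (n := 1)).differentiable one_ne_zero t).hasDerivAt.fun_mul
        (Real.hasDerivAt_cos t)).const_mul L)).deriv
  have dZ₂ : ∀ t, deriv Z₂ t =
      deriv z₂ t - L * (deriv ψ t * Real.sin t + ψ t * Real.cos t) := fun t =>
    ((h₂.differentiable hr0 t).hasDerivAt.fun_sub
      ((((hψ (n := 1)).differentiable one_ne_zero t).hasDerivAt.fun_mul
        (Real.hasDerivAt_sin t)).const_mul L)).deriv
  have hS0 : ∀ {t}, t ≤ b + 4 → S t = 0 := fun h =>
    Real.smoothTransition.zero_of_nonpos (by linarith)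
  have hS1 : ∀ {t}, b + 5 ≤ t → S t = 1 := fun h =>
    Real.smoothTransition.one_of_one_le (by linarith)
  refine ⟨Y, Z₁, Z₂, hy.add (contDiff_const.mul (hH.sub (contDiff_const.mul hS))),
    h₁.add (contDiff_const.mul (hψ.mul Real.contDiff_cos)),
    h₂.sub (contDiff_const.mul (hψ.mul Real.contDiff_sin)), fun t ht => ?_, fun t ht => ?_,
    fun t ht => ?_⟩
  · have e1 : ψ t = 0 := smoothPlateau_of_le (by linarith [ht.2])
    have e2 : S t = 0 := hS0 (by linarith [ht.2])
    have e3 : H t = 0 := smoothDeadZone_of_mem hε ht.1 ht.2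
    simp [Y, Z₁, Z₂, e1, e2, e3]
  -- Near a - 3 and b + 7 the curve data, ψ and the derivative of S all vanish. H differs by exactly
  -- 10 between corresponding points, and S by 1.
  · rw [abs_lt] at ht
    have n1 : t ∉ Set.Ioo (a - 2) (b + 2) := fun h => by linarith [h.1]
    have n2 : t + (b - a + 10) ∉ Set.Ioo (a - 2) (b + 2) := fun h => by linarith [h.2]
    have e1 : ψ t = 0 := smoothPlateau_of_le (by linarith)
    have e2 : ψ (t + (b - a + 10)) = 0 := smoothPlateau_of_ge (by linarith)
    have e3 : S t = 0 := hS0 (by linarith)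
    have e4 : S (t + (b - a + 10)) = 1 := hS1 (by linarith)
    have e5 : H t = t - a := smoothDeadZone_of_le hε hab (by linarith)
    have e6 : H (t + (b - a + 10)) = t + (b - a + 10) - b :=
      smoothDeadZone_of_ge hε hab (by linarith)
    simp only [Y, Z₁, Z₂, e1, e2, e3, e4, e5, e6, hy0 _ n1, hy0 _ n2, hz₁ _ n1, hz₁ _ n2,
      hz₂ _ n1, hz₂ _ n2]
    refine ⟨by ring, by ring, by ring⟩
  · by_cases htb : t < b + 3
    · have e1 : ψ t = 0 := smoothPlateau_of_le htb.le
      have e2 : deriv ψ t = 0 :=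
        deriv_eq_zero_of_eqOn isOpen_Iio (fun u hu => smoothPlateau_of_le (le_of_lt hu)) htb
      have e3 : deriv S t = 0 := deriv_eq_zero_of_eqOn isOpen_Iio
        (fun u (hu : u < b + 4) => hS0 (le_of_lt hu)) (show t < b + 4 by linarith)
      have e4 : timelikeMargin c Y Z₁ Z₂ t = timelikeMargin c y z₁ z₂ t + c * M * deriv H t := by
        simp only [timelikeMargin, dY, dZ₁, dZ₂, e1, e2, e3, Z₁, Z₂, zero_mul, mul_zero, add_zero,
          sub_zero]
        ring
      rw [e4]
      have hcM0 : 0 < c * M := by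
        rw [hcM]
        positivity
      by_cases hmem : t ∈ Set.Icc (a - ε) (b + ε)
      · have := deriv_smoothDeadZone_nonneg hε a b t
        have h3 := hpos t hmem
        have := mul_nonneg hcM0.le this
        linarith
      · have h4 : deriv H t = 1 := deriv_smoothDeadZone_of_notMem hε hab hmem
        rw [h4, hcM]
        have := neg_le_of_abs_le (hB t ht)
        have : 0 ≤ L * C₁ := by positivity
        linarith
    · push Not at htb
      have hmem : ∀ u, b + 2 < u → u ∉ Set.Ioo (a - 2) (b + 2) := fun u hu h => by linarith [h.2]
      have ht2 : b + 2 < t := by linarith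
      have d0 : deriv y t = 0 :=
        deriv_eq_zero_of_eqOn isOpen_Ioi (fun u hu => hy0 u (hmem u hu)) ht2
      have d1 : deriv z₁ t = 0 :=
        deriv_eq_zero_of_eqOn isOpen_Ioi (fun u hu => hz₁ u (hmem u hu)) ht2
      have d2 : deriv z₂ t = 0 :=
        deriv_eq_zero_of_eqOn isOpen_Ioi (fun u hu => hz₂ u (hmem u hu)) ht2
      have d3 : deriv H t = 1 :=
        deriv_smoothDeadZone_of_notMem hε hab fun h => by linarith [h.2]
      have sq := Real.sin_sq_add_cos_sq t
      have hsq : (L * (deriv ψ t * Real.cos t + ψ t * -Real.sin t)) ^ 2 +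
          (-(L * (deriv ψ t * Real.sin t + ψ t * Real.cos t))) ^ 2 =
          L ^ 2 * (deriv ψ t ^ 2 + ψ t ^ 2) := by
        linear_combination L ^ 2 * (deriv ψ t ^ 2 + ψ t ^ 2) * sq
      have e4 : timelikeMargin c Y Z₁ Z₂ t =
          c * M + c * (L ^ 2 / 2 * ψ t ^ 2 - 10 * M * deriv S t)
            - L * √(deriv ψ t ^ 2 + ψ t ^ 2) := by
        have v1 : Z₁ t = L * (ψ t * Real.cos t) := by
          simp only [Z₁, hz₁ t (hmem t ht2), zero_add]
        have v2 : Z₂ t = -(L * (ψ t * Real.sin t)) := by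
          simp only [Z₂, hz₂ t (hmem t ht2), zero_sub]
        rw [timelikeMargin, dY, dZ₁, dZ₂, d0, d1, d2, d3, v1, v2, zero_add, zero_add, zero_sub, hsq,
          Real.sqrt_mul (by positivity), Real.sqrt_sq (by linarith)]
        linear_combination (c * L ^ 2 / 2 * ψ t ^ 2) * sq
      have e5 : L * √(deriv ψ t ^ 2 + ψ t ^ 2) ≤ L * C₁ :=
        mul_le_mul_of_nonneg_left ((le_abs_self _).trans (hC₁ t ht)) (by linarith)
      -- S varies only on [b + 4, b + 5], where ψ = 1 and the full area gain is available.
      have e6 : 0 ≤ L ^ 2 / 2 * ψ t ^ 2 - 10 * M * deriv S t := by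
        by_cases h45 : t ∈ Set.Icc (b + 4) (b + 5)
        · have : ψ t = 1 := smoothPlateau_of_mem (by linarith [h45.1]) (by linarith [h45.2])
          rw [this]
          have h6 : 10 * M * deriv S t ≤ 10 * M * C₂ :=
            mul_le_mul_of_nonneg_left ((le_abs_self _).trans (hC₂ t ht)) (by linarith)
          linarith
        · have : deriv S t = 0 := by
            rw [Set.mem_Icc, not_and_or, not_le, not_le] at h45
            rcases h45 with h | h
            · exact deriv_eq_zero_of_eqOn isOpen_Iio
                (fun u (hu : u < b + 4) => hS0 (le_of_lt hu)) h
            · exact deriv_eq_zero_of_eqOn isOpen_Ioi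
                (fun u (hu : b + 5 < u) => hS1 (le_of_lt hu)) h
          rw [this]
          nlinarith [sq_nonneg (L * ψ t)]
      rw [e4, hcM]
      have := mul_nonneg hc.le e6
      linarith

/-- Multiplying by a plateau equal to 1 on [a - 1, b + 1] reduces to compact support. The margin
stays positive on [a - ε, b + ε] because ε < 1. -/
theorem exists_closing {c : ℝ} (hc : 0 < c) {r : ℕ∞} (hr : 1 ≤ (r : ℕ∞ω)) {a b : ℝ}
    (hab : a ≤ b) {y z₁ z₂ : ℝ → ℝ} (hy : ContDiff ℝ r y)
    (h₁ : ContDiff ℝ r z₁) (h₂ : ContDiff ℝ r z₂)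
    (hpos : ∀ t ∈ Set.Icc a b, 0 < timelikeMargin c y z₁ z₂ t) :
    ∃ Y Z₁ Z₂ : ℝ → ℝ, ContDiff ℝ r Y ∧ ContDiff ℝ r Z₁ ∧ ContDiff ℝ r Z₂ ∧
      (∀ t ∈ Set.Icc a b, Y t = y t ∧ Z₁ t = z₁ t ∧ Z₂ t = z₂ t) ∧
      (∀ t, |t - (a - 3)| < 1 → Y (t + (b - a + 10)) = Y t ∧ Z₁ (t + (b - a + 10)) = Z₁ t ∧
        Z₂ (t + (b - a + 10)) = Z₂ t) ∧
      ∀ t ∈ Set.Icc (a - 3) (b + 7), 0 < timelikeMargin c Y Z₁ Z₂ t := by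
  obtain ⟨ε, hε, hε1, hF⟩ :=
    exists_margin_neighborhood (continuous_timelikeMargin c hr hy h₁ h₂) hab hpos
  let χ := smoothPlateau (a - 2) (b + 2)
  have hχ : ContDiff ℝ r χ := contDiff_smoothPlateau _ _
  have hχ0 : ∀ t, t ∉ Set.Ioo (a - 2) (b + 2) → χ t = 0 := fun t ht => by
    rw [Set.mem_Ioo, not_and_or, not_lt, not_lt] at ht
    exact ht.elim smoothPlateau_of_le smoothPlateau_of_ge
  have hχ1 : ∀ f : ℝ → ℝ, ∀ t ∈ Set.Ioo (a - 1) (b + 1), χ t * f t = f t := fun f t ht => by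
    have : χ t = 1 := smoothPlateau_of_mem (by linarith [ht.1]) (by linarith [ht.2])
    rw [this, one_mul]
  have hev : ∀ f : ℝ → ℝ, ∀ t ∈ Set.Ioo (a - 1) (b + 1), (fun s => χ s * f s) =ᶠ[nhds t] f :=
    fun f t ht => Filter.eventually_of_mem (isOpen_Ioo.mem_nhds ht) (hχ1 f)
  have hz : ∀ f : ℝ → ℝ, ∀ t, t ∉ Set.Ioo (a - 2) (b + 2) → χ t * f t = 0 := fun f t ht => by
    rw [hχ0 t ht, zero_mul]
  obtain ⟨Y, Z₁, Z₂, HY, H₁, H₂, heq, hper, hm⟩ := exists_closing_of_compact hc hr hab hε hε1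
    (hχ.mul hy) (hχ.mul h₁) (hχ.mul h₂) (hz y) (hz z₁) (hz z₂) fun t ht => by
      have ht' : t ∈ Set.Ioo (a - 1) (b + 1) := ⟨by linarith [ht.1], by linarith [ht.2]⟩
      have := timelikeMargin_congr c (hev y t ht') (hev z₁ t ht') (hev z₂ t ht')
      exact this ▸ hF t ht
  refine ⟨Y, Z₁, Z₂, HY, H₁, H₂, fun t ht => ?_, hper, hm⟩
  have ht' : t ∈ Set.Ioo (a - 1) (b + 1) := ⟨by linarith [ht.1], by linarith [ht.2]⟩
  simpa only [hχ1 _ t ht'] using heq t ht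

theorem isTimelike_three_iff (c : ℝ) (x v : Fin 3 → ℝ) :
    IsTimelike (explicitMetric 0 c) x v ↔
      v 1 ^ 2 + v 2 ^ 2 < (c * (v 0 + x 2 * v 1)) ^ 2 := by
  have h := metricForm_explicitMetric' (m := 0) c x v v
  rw [Finset.univ_eq_empty, Finset.sum_empty] at h
  rw [IsTimelike, h]
  constructor <;> intro h <;> linarith

theorem exists_sign_of_ne_zero {f : ℝ → ℝ} {a b : ℝ} (hf : Continuous f)
    (h : ∀ t ∈ Set.Icc a b, f t ≠ 0) :
    ∃ σ : ℝ, (σ = 1 ∨ σ = -1) ∧ ∀ t ∈ Set.Icc a b, 0 < σ * f t := by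
  by_cases hab : a ≤ b
  · have key : ∀ g : ℝ → ℝ, Continuous g → (∀ t ∈ Set.Icc a b, g t ≠ 0) → 0 < g a →
        ∀ t ∈ Set.Icc a b, 0 < g t := fun g hg h0 ha t ht => by
      by_contra hn
      obtain ⟨s, hs, hs0⟩ := intermediate_value_Icc' ht.1 hg.continuousOn ⟨not_lt.1 hn, ha.le⟩
      exact h0 s ⟨hs.1, hs.2.trans ht.2⟩ hs0
    rcases (h a ⟨le_rfl, hab⟩).lt_or_gt with ha | ha
    · refine ⟨-1, Or.inr rfl, fun t ht => ?_⟩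
      have := key (fun t => -f t) hf.neg (fun t ht => neg_ne_zero.2 (h t ht)) (neg_pos.2 ha) t ht
      linarith
    · refine ⟨1, Or.inl rfl, fun t ht => ?_⟩
      have := key f hf h ha t ht
      linarith
  · exact ⟨1, Or.inl rfl, fun t ht => absurd (ht.1.trans ht.2) hab⟩

theorem exists_closed_timelike_extension {c : ℝ} (hc : 0 < c) {r : ℕ∞} (hr : 1 ≤ r) {a b : ℝ}
    (hab : a < b) {w : ℝ → Fin 3 → ℝ} (hw : IsTimelikePathOn (explicitMetric 0 c) r a b w) :
    ∃ (α β : ℝ) (γ : ℝ → Fin 3 → ℝ), α ≤ a ∧ b ≤ β ∧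
      IsClosedTimelikePath (explicitMetric 0 c) r (β - α) γ ∧ Set.EqOn γ w (Set.Icc a b) := by
  have hr' : 1 ≤ (r : ℕ∞ω) := by exact_mod_cast hr
  have hr0 : (r : ℕ∞ω) ≠ 0 := (zero_lt_one.trans_le hr').ne'
  obtain ⟨W, hW, hWw⟩ := hw.1.exists_contDiff_extension_Icc hab
  have hWi : ∀ i, ContDiff ℝ r fun t => W t i := contDiff_pi.1 hW
  have hWd : ∀ t i, HasDerivAt (fun t => W t i) (deriv W t i) t := fun t =>
    hasDerivAt_pi.1 (hW.differentiable hr0 t).hasDerivAt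
  have hWdi : ∀ t i, deriv (fun t => W t i) t = deriv W t i := fun t i => (hWd t i).deriv
  have htl : ∀ t ∈ Set.Icc a b, deriv W t 1 ^ 2 + deriv W t 2 ^ 2 <
      (c * (deriv W t 0 + W t 2 * deriv W t 1)) ^ 2 := fun t ht => by
    have h := hw.2 t ht
    rw [← derivWithin_congr hWw (hWw ht), ← hWw ht, (hW.differentiable hr0 t).derivWithin
      (uniqueDiffOn_Icc hab t ht)] at h
    exact (isTimelike_three_iff c _ _).1 h
  have hcont : Continuous fun t => deriv W t 0 + W t 2 * deriv W t 1 := by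
    have h1 : ∀ i, Continuous fun t => deriv W t i :=
      fun i => (continuous_apply i).comp (hW.continuous_deriv hr')
    exact (h1 0).add ((hWi 2).continuous.mul (h1 1))
  -- θ(w') cannot vanish on a timelike curve, so it has a constant sign. The isometry (x_0, x_1,
  -- x_2) ↦ (-x_0, -x_1, x_2) reverses θ, and σ inserts it when the sign is negative.
  obtain ⟨σ, hσ, hσpos⟩ := exists_sign_of_ne_zero (a := a) (b := b) hcont fun t ht h => by
    have := htl t ht
    rw [h, mul_zero] at this
    nlinarith [sq_nonneg (deriv W t 1), sq_nonneg (deriv W t 2)]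
  have hσ2 : σ ^ 2 = 1 := by rcases hσ with rfl | rfl <;> norm_num
  have hy : ContDiff ℝ r fun t => σ * (W t 0 + W t 1 * W t 2 / 2) :=
    contDiff_const.mul ((hWi 0).add (((hWi 1).mul (hWi 2)).div_const 2))
  have h₁ : ContDiff ℝ r fun t => σ * W t 1 := contDiff_const.mul (hWi 1)
  obtain ⟨Y, Z₁, Z₂, HY, H₁, H₂, heq, hper, hm⟩ := exists_closing hc hr' hab.le hy h₁ (hWi 2)
    fun t ht => by
      have d0 : deriv (fun t => σ * (W t 0 + W t 1 * W t 2 / 2)) t =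
          σ * (deriv W t 0 + (deriv W t 1 * W t 2 + W t 1 * deriv W t 2) / 2) :=
        (((hWd t 0).fun_add (((hWd t 1).fun_mul (hWd t 2)).div_const 2)).const_mul σ).deriv
      have d1 : deriv (fun t => σ * W t 1) t = σ * deriv W t 1 := ((hWd t 1).const_mul σ).deriv
      rw [timelikeMargin, d0, d1, hWdi, mul_pow, hσ2, one_mul, sub_pos]
      have e : c * (σ * (deriv W t 0 + (deriv W t 1 * W t 2 + W t 1 * deriv W t 2) / 2) +
          (W t 2 * (σ * deriv W t 1) - σ * W t 1 * deriv W t 2) / 2) =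
          c * (σ * (deriv W t 0 + W t 2 * deriv W t 1)) := by ring
      rw [e, Real.sqrt_lt' (mul_pos hc (hσpos t ht))]
      calc _ < _ := htl t ht
        _ = _ := by linear_combination (-(c * (deriv W t 0 + W t 2 * deriv W t 1)) ^ 2) * hσ2
  -- Inverse of the change of coordinates y = σ(x_0 + x_1x_2/2), z_1 = σx_1, z_2 = x_2.
  let U : ℝ → Fin 3 → ℝ := fun t => ![σ * (Y t - Z₁ t * Z₂ t / 2), σ * Z₁ t, Z₂ t]
  have hU : ContDiff ℝ r U := by
    rw [contDiff_pi]
    intro i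
    fin_cases i
    · exact contDiff_const.mul (HY.sub ((H₁.mul H₂).div_const 2))
    · exact contDiff_const.mul H₁
    · exact H₂
  have hUper : ∀ t, |t - (a - 3)| < 1 → U (t + (b - a + 10)) = U t := fun t ht => by
    obtain ⟨e0, e1, e2⟩ := hper t ht
    simp only [U, e0, e1, e2]
  have hUt : ∀ t ∈ Set.Icc (a - 3) (b + 7), IsTimelike (explicitMetric 0 c) (U t) (deriv U t) :=
    fun t ht => by
      have dY := (HY.differentiable hr0 t).hasDerivAt
      have dZ₁ := (H₁.differentiable hr0 t).hasDerivAt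
      have dZ₂ := (H₂.differentiable hr0 t).hasDerivAt
      have hd := hasDerivAt_pi.1 (hU.differentiable hr0 t).hasDerivAt
      have d0 : deriv U t 0 =
          σ * (deriv Y t - (deriv Z₁ t * Z₂ t + Z₁ t * deriv Z₂ t) / 2) :=
        (hd 0).unique ((dY.fun_sub ((dZ₁.fun_mul dZ₂).div_const 2)).const_mul σ)
      have d1 : deriv U t 1 = σ * deriv Z₁ t := (hd 1).unique (dZ₁.const_mul σ)
      have d2 : deriv U t 2 = deriv Z₂ t := (hd 2).unique dZ₂
      have hU2 : U t 2 = Z₂ t := rfl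
      rw [isTimelike_three_iff, d0, d1, d2, hU2]
      have h := sub_pos.1 (hm t ht)
      have hp := (Real.sqrt_nonneg _).trans_lt h
      rw [Real.sqrt_lt' hp] at h
      calc _ = deriv Z₁ t ^ 2 + deriv Z₂ t ^ 2 := by rw [mul_pow, hσ2, one_mul]
        _ < _ := h
        _ = _ := by
          linear_combination
            (-(c * (deriv Y t + (Z₂ t * deriv Z₁ t - Z₁ t * deriv Z₂ t) / 2)) ^ 2) * hσ2
  have hT : 0 < b - a + 10 := by linarith
  obtain ⟨γ, hγ, hγp, hγU, hγd⟩ := exists_periodic_of_overlap hT one_pos hU hUper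
  refine ⟨a - 3, b + 7, γ, by linarith, by linarith, ?_, fun t ht => ?_⟩
  · have hTe : b + 7 - (a - 3) = b - a + 10 := by ring
    rw [hTe]
    refine ⟨hT, hγ, hγp, fun t => ?_⟩
    obtain ⟨s, hs, hs1, hs2⟩ := hγd t
    rw [hs1, hs2]
    exact hUt s ⟨hs.1, by linarith [hs.2]⟩
  · rw [hγU t ⟨by linarith [ht.1], by linarith [ht.2]⟩, ← hWw ht]
    obtain ⟨e0, e1, e2⟩ := heq t ht
    funext i
    fin_cases i
    · change σ * (Y t - Z₁ t * Z₂ t / 2) = W t 0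
      rw [e0, e1, e2]
      linear_combination (W t 0) * hσ2
    · change σ * Z₁ t = W t 1
      rw [e1]
      linear_combination (W t 1) * hσ2
    · exact e2

/-! ### Closed timelike curves through a given point. -/

theorem exists_closed_timelike_through (m : ℕ) {c : ℝ} (hc : 0 < c) (r : ℕ∞)
    (p : Fin (m + 3) → ℝ) : ∃ (T : ℝ) (γ : ℝ → Fin (m + 3) → ℝ),
      IsClosedTimelikePath (explicitMetric m c) r T γ ∧ ∃ t, γ t = p := by
  -- The curve lies over a circle of radius R in the (x_1, x_2)-plane, with x_0 chosen so that θ(γ')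
  -- is the constant -R²/2; the enclosed area makes x_0 close up. It is timelike once c²R⁴/4 > R²,
  -- that is cR > 2, and cR = 3 is taken.
  let R := 3 / c
  let γ : ℝ → Fin (m + 3) → ℝ := fun t => vecOf
    (p 0 - (p 2 + R) * R * Real.sin t + R ^ 2 / 2 * (Real.sin t * Real.cos t))
    (p 1 + R * Real.sin t) (p 2 + R * (1 - Real.cos t)) p
  let γ' : ℝ → Fin (m + 3) → ℝ := fun t => vecOf
    (-(p 2 + R) * R * Real.cos t + R ^ 2 / 2 * (Real.cos t * Real.cos t
      + Real.sin t * -Real.sin t)) (R * Real.cos t) (R * Real.sin t) 0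
  have h : ∀ t k, HasDerivAt (fun s => γ s k) (γ' t k) t := fun t => by
    have hs := Real.hasDerivAt_sin t
    have hk := Real.hasDerivAt_cos t
    refine vecOf_induction ?_ ?_ ?_ fun k h0 h1 h2 => ?_
    · simp only [γ, γ', vecOf_zero]
      refine (((hs.const_mul ((p 2 + R) * R)).const_sub (p 0)).fun_add
        ((hs.fun_mul hk).const_mul (R ^ 2 / 2))).congr_deriv ?_
      ring
    · simp only [γ, γ', vecOf_one]
      exact (hs.const_mul R).const_add (p 1)
    · simp only [γ, γ', vecOf_two]
      refine (((hk.const_sub 1).const_mul R).const_add (p 2)).congr_deriv ?_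
      ring
    · simp only [γ, γ', vecOf_of_ne _ _ _ _ h0 h1 h2]
      exact hasDerivAt_const t (p k)
  refine ⟨2 * Real.pi, γ, ⟨by positivity, ?_, fun t => ?_, fun t => ?_⟩, 0, ?_⟩
  · rw [contDiff_pi]
    refine vecOf_induction ?_ ?_ ?_ fun k h0 h1 h2 => ?_
    · simp only [γ, vecOf_zero]
      fun_prop
    · simp only [γ, vecOf_one]
      fun_prop
    · simp only [γ, vecOf_two]
      fun_prop
    · simp only [γ, vecOf_of_ne _ _ _ _ h0 h1 h2]
      exact contDiff_const
  · simp only [γ, Real.sin_add_two_pi, Real.cos_add_two_pi]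
  · rw [deriv_eq_of_hasDerivAt_apply h, IsTimelike, metricForm_explicitMetric', Finset.sum_eq_zero]
    · simp only [γ, γ', vecOf_zero, vecOf_one, vecOf_two]
      have sq := Real.sin_sq_add_cos_sq t
      have hcR : c * R = 3 := by
        simp only [R]
        field_simp
      have hR : 0 < R := by positivity
      have e : -(p 2 + R) * R * Real.cos t + R ^ 2 / 2 * (Real.cos t * Real.cos t
          + Real.sin t * -Real.sin t) + (p 2 + R * (1 - Real.cos t)) * (R * Real.cos t) =
          -R ^ 2 / 2 := by
        linear_combination (-R ^ 2 / 2) * sq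
      rw [e]
      have e2 : -c ^ 2 * (-R ^ 2 / 2) * (-R ^ 2 / 2) + R * Real.cos t * (R * Real.cos t) +
          R * Real.sin t * (R * Real.sin t) + 0 = -(5 / 4) * R ^ 2 := by
        linear_combination R ^ 2 * sq - (R ^ 2 / 4) * (c * R + 3) * hcR
      rw [e2]
      nlinarith
    · intro i _
      obtain ⟨h0, h1, h2⟩ := succ_succ_succ_ne i
      simp [γ', vecOf_of_ne _ _ _ _ h0 h1 h2]
  · funext k
    revert k
    refine vecOf_induction ?_ ?_ ?_ fun k h0 h1 h2 => ?_
    · simp [γ, vecOf_zero]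
    · simp [γ, vecOf_one]
    · simp [γ, vecOf_two]
    · simp [γ, vecOf_of_ne _ _ _ _ h0 h1 h2]

end

theorem mainTheorem7 (m : ℕ) (c : ℝ) (hc : 0 < c) :
    -- scaling: `g^c_n = (1/c^2) φ_c^* g^1_n`, and `c^2 g^c_n` is isometric to `g^1_n`
    (IsDiffeo (scalingMap m c) ∧
      explicitMetric m c =
        (1 / c ^ 2) • pullbackMetric (scalingMap m c) (explicitMetric m 1) ∧
      AreIsometric (c ^ 2 • explicitMetric m c) (explicitMetric m 1)) ∧
    -- geodesic completeness
    GeodesicallyComplete (explicitMetric m c) ∧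
    -- there is no closed causal geodesic
    (¬ ∃ γ, IsClosedCausalGeodesic (explicitMetric m c) γ) ∧
    -- through each point there is a smooth one-parameter family of distinct closed spacelike geodesics
    (∀ p : Fin (m + 3) → ℝ, ∃ Γ : ℝ → ℝ → Fin (m + 3) → ℝ,
      ContDiff ℝ ∞ (Function.uncurry Γ) ∧
      (∀ s, IsClosedSpacelikeGeodesic (explicitMetric m c) (Γ s) ∧ Γ s 0 = p) ∧
      Function.Injective fun s => Set.range (Γ s)) ∧
    -- in dimension three, timelike paths extend to closed timelike paths
    (∀ (r : ℕ∞), 1 ≤ r → ∀ (a b : ℝ), a < b → ∀ w : ℝ → Fin 3 → ℝ,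
      IsTimelikePathOn (explicitMetric 0 c) r a b w →
      ∃ (α β : ℝ) (γ : ℝ → Fin 3 → ℝ), α ≤ a ∧ b ≤ β ∧
        IsClosedTimelikePath (explicitMetric 0 c) r (β - α) γ ∧ Set.EqOn γ w (Set.Icc a b)) ∧
    -- there are closed timelike paths through each point
    (∀ (r : ℕ∞), 1 ≤ r → ∀ p : Fin (m + 3) → ℝ, ∃ (T : ℝ) (γ : ℝ → Fin (m + 3) → ℝ),
      IsClosedTimelikePath (explicitMetric m c) r T γ ∧ ∃ t, γ t = p) ∧
    -- curvature conditions
    TimelikeConvergence (explicitMetric m c) ∧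
    (∀ Λ : ℝ, Λ ≤ c ^ 2 / 4 → DominantEnergyCondition (explicitMetric m c) Λ) := by
  refine ⟨⟨scalingMap_isDiffeo m hc, explicitMetric_scaling m hc,
      ⟨scalingMap m c, scalingMap_isDiffeo m hc, pullbackMetric_scalingMap m c⟩⟩,
    geodesicallyComplete_explicitMetric m hc,
    fun ⟨γ, hγ⟩ => not_isClosedCausalGeodesic hc γ hγ,
    exists_closed_spacelike_family hc,
    fun r hr a b hab w hw => exists_closed_timelike_extension hc hr hab hw,
    fun r _ p => exists_closed_timelike_through m hc r p,
    timelikeConvergence_explicitMetric m hc,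
    fun Λ hΛ => dominantEnergyCondition_explicitMetric m hc hΛ⟩
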